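/- **Theorem.** Let $\mathbb K$ be one of the normed division algebras $\mathbb R,\mathbb C,\mathbb H,\mathbb O$, of real dimension $n=1,2,4,8$, with conjugation $a\mapsto a^*$ and real part $\mathrm{Re}$. For a $2\times2$ matrix $A$ put $\tilde A=A-(\operatorname{tr}A)1$, and let $$\mathcal V=\left\{\begin{pmatrix} a&\tilde A\\ A&-a\end{pmatrix}: a\in\mathbb R,\ A\in\mathfrak h_2(\mathbb K)\right\},\qquad h(\mathcal A,\mathcal B)=\tfrac14\mathrm{Re}\operatorname{tr}(\mathcal A\mathcal B),$$ where $\mathfrak h_2(\mathbb K)$ is the space of hermitian $2\times 2$ matrices over $\mathbb K$. Then $(\mathcal V,h)$ is a Minkowski spacetime of dimension $n+3=4,5,7,11$ and signature $(n+2,1)$. Let $\mathcal S=\mathbb K^4$, let $\Gamma(\mathcal A)\Psi=\mathcal A\Psi$ for $\mathcal A\in\mathcal V$, $\Psi\in\mathcal S$, let $\langle\Psi,\Phi\rangle=\mathrm{Re}(\Psi^\dagger\Gamma^0\Phi)$ with $\Gamma^0=\begin{pmatrix}0&-1\\1&0\end{pmatrix}$, and let $\Psi\cdot\Phi\in\mathcal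 V$ be the vector with $h(\Psi\cdot\Phi,\mathcal A)=\langle\Psi,\Gamma(\mathcal A)\Phi\rangle$ for all $\mathcal A\in\mathcal V$. Let $\mathcal T=\mathcal V\oplus\mathcal S$ be the supertranslation algebra, with even part $\mathcal V$, odd part $\mathcal S$, and only nonzero bracket $[\Psi,\Phi]=\Psi\cdot\Phi$. The Lorentz algebra $\mathfrak{so}(n+2,1)$ of $h$-skew-adjoint endomorphisms of $\mathcal V$ acts on $\mathcal V$, and on $\mathcal S$ by the spinor representation $X\mapsto\frac14\sum_i\Gamma(Xe_i)\Gamma(e^i)$, where $(e_i)$ is a basis of $\mathcal V$ and $(e^i)$ its $h$-dual basis. Let $\mathfrak{siso}(n+2,1)=\mathfrak{so}(n+2,1)\ltimes\mathcal T$. Let $\beta$ be the super-skew-symmetric 4-linear form on $\mathcal T$ that vanishes on homogeneous arguments unless exactly two of them are vectors and two are spinors, and has $$\beta(\Psi,\Phi,\mathcal A,\mathcal B)=\langle\Psi,(\Gamma(\mathcal A)\Gamma(\mathcal B)-\Gamma(\mathcal B)\Gamma(\mathcal A))\Phi\rangle ,$$ and extend it to $\mathfrak{siso}(n+2,1)$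 so that it vanishes whenever one argument lies in $\mathfrak{so}(n+2,1)$. Then $\mathfrak{siso}(n+2,1)$ is a Lie superalgebra, and $\beta$ is an even 4-cocycle on it with values in the trivial representation $\mathbb R$ (in the Chevalley–Eilenberg complex of Lie superalgebras) which is nontrivial, i.e. not a coboundary. Moreover, the bigraded space with $\mathfrak{siso}(n+2,1)$ in degree $0$ and $\mathbb R$ (of even parity) in degree $2$, with $l_2$ the bracket of $\mathfrak{siso}(n+2,1)$ (zero if an argument is in $\mathbb R$), $l_4=\beta$ (zero if an argument is in $\mathbb R$) and all other brackets $l_k$ zero, is a Lie 3-superalgebra, i.e. an $L_\infty$-superalgebra with nonzero terms only in degrees $0,1,2$. It is called the 2-brane Lie 3-superalgebra $\text{2-}\mathfrak{brane}(n+2,1)$. It is nonexact, where a Lie 3-superalgebra is called exact if only its terms $V_0$ and $V_2$ are nonzero, $d=l_1=0$, and its 4-cocycle $l_4$ on $V_0$ with values in $V_2$ is a coboundary. Finally, it is an extension of $\mathfrak{siso}(n+2,1)$: there is a short exact sequence of $L_\infty$-superalgebras $$0\to b^2\mathbb R\to\text{2-}\mathfrak{brane}(n+2,1)\to\mathfrak{siso}(n+2,1)\to0$$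 given by the inclusion and the projection, where $b^2\mathbb R$ is the abelian $L_\infty$-superalgebra with $\mathbb R$ in degree $2$. -/

import Mathlib

open scoped Quaternion Matrix

noncomputable section

namespace Brane

/-! ## Normed division algebras -/

/-- A normed division algebra: a finite-dimensional, possibly nonassociative, unital real algebra
with a conjugation `star` whose real part `re a` is given by `a + a* = 2 re(a) 1`, such that
`|a|² = re (a a*)` is positive definite and multiplicative. -/
class NormedDivisionAlgebra (K : Type) extends NonAssocRing K, StarRing K, Module ℝ K where
  real_smul_mul : ∀ (r : ℝ) (a b : K), (r • a) * b = r • (a * b)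
  mul_real_smul : ∀ (r : ℝ) (a b : K), a * (r • b) = r • (a * b)
  finite : Module.Finite ℝ K
  re : K →ₗ[ℝ] ℝ
  re_one : re 1 = 1
  add_star : ∀ a : K, a + star a = (2 * re a) • (1 : K)
  normSq_pos : ∀ a : K, a ≠ 0 → 0 < re (a * star a)
  normSq_mul : ∀ a b : K, re ((a * b) * star (a * b)) = re (a * star a) * re (b * star b)

open NormedDivisionAlgebra (re)

instance (K : Type) [NormedDivisionAlgebra K] : Module.Finite ℝ K := NormedDivisionAlgebra.finite

instance (K : Type) [NormedDivisionAlgebra K] : IsScalarTower ℝ K K :=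
  ⟨NormedDivisionAlgebra.real_smul_mul⟩

instance (K : Type) [NormedDivisionAlgebra K] : SMulCommClass ℝ K K :=
  ⟨fun r a b => (NormedDivisionAlgebra.mul_real_smul r a b).symm⟩

instance : NormedDivisionAlgebra ℝ :=
  { (inferInstance : NonAssocRing ℝ), (inferInstance : StarRing ℝ),
    (inferInstance : Module ℝ ℝ) with
    real_smul_mul := fun r a b => smul_mul_assoc r a b
    mul_real_smul := fun r a b => mul_smul_comm r a b
    finite := inferInstance
    re := LinearMap.id
    re_one := rfl
    add_star := fun a => by simp; ring
    normSq_pos := fun a ha => by simpa using mul_self_pos.mpr ha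
    normSq_mul := fun a b => by simp; ring }

instance : NormedDivisionAlgebra ℂ :=
  { (inferInstance : NonAssocRing ℂ), (inferInstance : StarRing ℂ),
    (inferInstance : Module ℝ ℂ) with
    real_smul_mul := fun r a b => smul_mul_assoc r a b
    mul_real_smul := fun r a b => mul_smul_comm r a b
    finite := inferInstance
    re := Complex.reLm
    re_one := rfl
    add_star := fun a => by
      apply Complex.ext <;> simp
      ring
    normSq_pos := fun a ha => by
      have := Complex.normSq_pos.mpr ha
      simpa [Complex.normSq_apply] using this
    normSq_mul := fun a b => by simp; ring }

/-- The real part of a quaternion, as a linear map. -/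
def quaternionRe : ℍ[ℝ] →ₗ[ℝ] ℝ where
  toFun a := a.re
  map_add' _ _ := rfl
  map_smul' _ _ := rfl

theorem quaternionRe_apply (a : ℍ[ℝ]) : quaternionRe a = a.re := rfl

instance : NormedDivisionAlgebra ℍ[ℝ] :=
  { (inferInstance : NonAssocRing ℍ[ℝ]), (inferInstance : StarRing ℍ[ℝ]),
    (inferInstance : Module ℝ ℍ[ℝ]) with
    real_smul_mul := fun r a b => smul_mul_assoc r a b
    mul_real_smul := fun r a b => mul_smul_comm r a b
    finite := inferInstance
    re := quaternionRe
    re_one := rfl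
    add_star := fun a => by
      apply QuaternionAlgebra.ext <;> simp [quaternionRe_apply]
      ring
    normSq_pos := fun a ha => by
      have h : (0 : ℝ) < Quaternion.normSq a :=
        lt_of_le_of_ne Quaternion.normSq_nonneg (Ne.symm (by simpa using ha))
      simpa [quaternionRe_apply, Quaternion.normSq_def] using h
    normSq_mul := fun a b => by
      have h := map_mul (Quaternion.normSq (R := ℝ)) a b
      simp only [Quaternion.normSq_def] at h
      exact h }

/-- The octonions, obtained from the quaternions by the Cayley--Dickson construction. -/
def Octonion : Type := ℍ[ℝ] × ℍ[ℝ]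

namespace Octonion

instance : AddCommGroup Octonion := inferInstanceAs (AddCommGroup (ℍ[ℝ] × ℍ[ℝ]))

instance : Module ℝ Octonion := inferInstanceAs (Module ℝ (ℍ[ℝ] × ℍ[ℝ]))

instance : Module.Finite ℝ Octonion := inferInstanceAs (Module.Finite ℝ (ℍ[ℝ] × ℍ[ℝ]))

instance : One Octonion := ⟨((1 : ℍ[ℝ]), (0 : ℍ[ℝ]))⟩

instance : Mul Octonion :=
  ⟨fun x y => (x.1 * y.1 - star y.2 * x.2, y.2 * x.1 + x.2 * star y.1)⟩

instance : Star Octonion := ⟨fun x => (star x.1, -x.2)⟩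

theorem ext' {x y : Octonion} (h₁ : x.1 = y.1) (h₂ : x.2 = y.2) : x = y := Prod.ext h₁ h₂

theorem mul_fst (x y : Octonion) : (x * y).1 = x.1 * y.1 - star y.2 * x.2 := rfl
theorem mul_snd (x y : Octonion) : (x * y).2 = y.2 * x.1 + x.2 * star y.1 := rfl
theorem one_fst : (1 : Octonion).1 = 1 := rfl
theorem one_snd : (1 : Octonion).2 = 0 := rfl
theorem zero_fst : (0 : Octonion).1 = 0 := rfl
theorem zero_snd : (0 : Octonion).2 = 0 := rfl
theorem add_fst (x y : Octonion) : (x + y).1 = x.1 + y.1 := rfl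
theorem add_snd (x y : Octonion) : (x + y).2 = x.2 + y.2 := rfl
theorem smul_fst (r : ℝ) (x : Octonion) : (r • x).1 = r • x.1 := rfl
theorem smul_snd (r : ℝ) (x : Octonion) : (r • x).2 = r • x.2 := rfl
theorem star_fst (x : Octonion) : (star x).1 = star x.1 := rfl
theorem star_snd (x : Octonion) : (star x).2 = -x.2 := rfl

instance : NonAssocRing Octonion :=
  { (inferInstance : AddCommGroup Octonion) with
    mul := (· * ·)
    one := 1
    left_distrib := fun x y z => by
      apply ext' <;> simp only [mul_fst, mul_snd, add_fst, add_snd, star_add] <;> noncomm_ring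
    right_distrib := fun x y z => by
      apply ext' <;> simp only [mul_fst, mul_snd, add_fst, add_snd] <;> noncomm_ring
    zero_mul := fun x => by
      apply ext' <;> simp [mul_fst, mul_snd, zero_fst, zero_snd]
    mul_zero := fun x => by
      apply ext' <;> simp [mul_fst, mul_snd, zero_fst, zero_snd]
    one_mul := fun x => by
      apply ext' <;> simp [mul_fst, mul_snd, one_fst, one_snd]
    mul_one := fun x => by
      apply ext' <;> simp [mul_fst, mul_snd, one_fst, one_snd] }

instance : StarRing Octonion where
  star_involutive x := by apply ext' <;> simp [star_fst, star_snd]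
  star_mul x y := by
    apply ext'
    · simp only [mul_fst, star_fst, star_snd, star_sub, star_mul, star_star, star_neg]
      noncomm_ring
    · simp only [mul_snd, star_fst, star_snd, star_star]
      noncomm_ring
  star_add x y := by
    apply ext' <;> simp only [add_fst, add_snd, star_fst, star_snd, star_add, neg_add]

/-- The real part of an octonion, as a linear map. -/
def reLin : Octonion →ₗ[ℝ] ℝ where
  toFun x := x.1.re
  map_add' _ _ := rfl
  map_smul' _ _ := rfl

theorem reLin_apply (x : Octonion) : reLin x = x.1.re := rfl

theorem re_mul_star (x : Octonion) :
    reLin (x * star x) = Quaternion.normSq x.1 + Quaternion.normSq x.2 := by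
  simp [reLin_apply, mul_fst, star_fst, star_snd, Quaternion.normSq_def', pow_two]

end Octonion

open Octonion in
instance : NormedDivisionAlgebra Octonion :=
  { (inferInstance : NonAssocRing Octonion), (inferInstance : StarRing Octonion),
    (inferInstance : Module ℝ Octonion) with
    real_smul_mul := fun r a b => by
      apply ext' <;> simp [mul_fst, mul_snd, smul_fst, smul_snd, smul_sub, smul_add]
    mul_real_smul := fun r a b => by
      apply ext' <;> simp [mul_fst, mul_snd, smul_fst, smul_snd, smul_sub, smul_add]
    finite := inferInstance
    re := reLin
    re_one := rfl
    add_star := fun a => by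
      apply ext'
      · apply QuaternionAlgebra.ext <;>
          simp [reLin_apply, add_fst, smul_fst, one_fst, star_fst]
        ring
      · simp [add_snd, smul_snd, one_snd, star_snd]
    normSq_pos := fun a ha => by
      have h := re_mul_star a
      refine lt_of_lt_of_eq ?_ h.symm
      by_contra hn
      have h1 : 0 ≤ Quaternion.normSq a.1 := Quaternion.normSq_nonneg
      have h2 : 0 ≤ Quaternion.normSq a.2 := Quaternion.normSq_nonneg
      exact ha (ext' (Quaternion.normSq_eq_zero.mp (by linarith))
        (Quaternion.normSq_eq_zero.mp (by linarith)))
    normSq_mul := fun a b => by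
      refine (re_mul_star (a * b)).trans ?_
      refine Eq.trans ?_ (congrArg₂ (· * ·) (re_mul_star a).symm (re_mul_star b).symm)
      simp [mul_fst, mul_snd, Quaternion.normSq_def']
      ring }

/-- Labels for the four normed division algebras. -/
inductive DivAlg
  | real
  | complex
  | quaternion
  | octonion

/-- The normed division algebra `ℝ`, `ℂ`, `ℍ` or `𝕆` with a given label. -/
@[reducible]
def DivAlg.carrier : DivAlg → Type
  | .real => ℝ
  | .complex => ℂ
  | .quaternion => ℍ[ℝ]
  | .octonion => Octonion

instance (k : DivAlg) : NormedDivisionAlgebra k.carrier :=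
  match k with
  | .real => inferInstanceAs (NormedDivisionAlgebra ℝ)
  | .complex => inferInstanceAs (NormedDivisionAlgebra ℂ)
  | .quaternion => inferInstanceAs (NormedDivisionAlgebra ℍ[ℝ])
  | .octonion => inferInstanceAs (NormedDivisionAlgebra Octonion)

/-- The real dimension `n = 1, 2, 4, 8`. -/
def DivAlg.dim : DivAlg → ℕ
  | .real => 1
  | .complex => 2
  | .quaternion => 4
  | .octonion => 8

/-! ## Vectors and spinors in dimension `n + 3` -/

section Spacetime

variable (K : Type) [NormedDivisionAlgebra K]

variable {K} in
theorem star_eq (a : K) : star a = (2 * re a) • (1 : K) - a :=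
  eq_sub_of_add_eq' (NormedDivisionAlgebra.add_star a)

variable {K} in
theorem star_smul' (r : ℝ) (a : K) : star (r • a) = r • star a := by
  rw [star_eq, star_eq, smul_sub, smul_smul, map_smul, smul_eq_mul]
  congr 2
  ring

/-- The index set of `K⁴ = K² ⊕ K²`. -/
abbrev Idx : Type := Fin 2 ⊕ Fin 2

/-- The `2 × 2` hermitian matrices `𝔥₂(K)`. -/
def herm : Submodule ℝ (Matrix (Fin 2) (Fin 2) K) where
  carrier := {A | Aᴴ = A}
  add_mem' {A B} hA hB := by
    simp only [Set.mem_ofPred_eq] at *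
    rw [Matrix.conjTranspose_add, hA, hB]
  zero_mem' := Matrix.conjTranspose_zero
  smul_mem' r A hA := by
    simp only [Set.mem_ofPred_eq] at *
    ext i j
    rw [Matrix.conjTranspose_apply, Matrix.smul_apply, star_smul', ← Matrix.conjTranspose_apply,
      hA, Matrix.smul_apply]

variable {K} in
/-- Trace reversal, `Ã = A - (tr A) 1`. -/
def traceRev (A : Matrix (Fin 2) (Fin 2) K) : Matrix (Fin 2) (Fin 2) K :=
  A - Matrix.diagonal fun _ => A.trace

variable {K} in
/-- The matrix with blocks `a, Ã; A, -a`. -/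
def vecMatrix (a : ℝ) (A : Matrix (Fin 2) (Fin 2) K) : Matrix Idx Idx K :=
  Matrix.fromBlocks (a • 1) (traceRev A) A (-(a • 1))

variable {K} in
theorem vecMatrix_add (a b : ℝ) (A B : Matrix (Fin 2) (Fin 2) K) :
    vecMatrix a A + vecMatrix b B = vecMatrix (a + b) (A + B) := by
  rw [vecMatrix, vecMatrix, vecMatrix, Matrix.fromBlocks_add]
  congr 1
  · rw [add_smul]
  · ext i j
    simp [traceRev, Matrix.diagonal_apply]
    split_ifs <;> abel
  · rw [add_smul, neg_add]

variable {K} in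
theorem vecMatrix_smul (r a : ℝ) (A : Matrix (Fin 2) (Fin 2) K) :
    r • vecMatrix a A = vecMatrix (r * a) (r • A) := by
  rw [vecMatrix, vecMatrix, Matrix.fromBlocks_smul]
  congr 1
  · rw [smul_smul]
  · ext i j
    simp [traceRev, Matrix.diagonal_apply, smul_sub]
  · rw [smul_neg, smul_smul]

/-- The vectors in `(n+3)`-dimensional Minkowski spacetime: the `4 × 4` matrices over `K` with
blocks `a, Ã; A, -a`, for `a` real and `A` hermitian. -/
def vecSubmodule : Submodule ℝ (Matrix Idx Idx K) where
  carrier := {M | ∃ a : ℝ, ∃ A ∈ herm K, M = vecMatrix a A}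
  add_mem' := by
    rintro _ _ ⟨a, A, hA, rfl⟩ ⟨b, B, hB, rfl⟩
    exact ⟨a + b, A + B, add_mem hA hB, vecMatrix_add a b A B⟩
  zero_mem' := ⟨0, 0, zero_mem _, by
    have := vecMatrix_smul (K := K) 0 0 0
    simpa using this⟩
  smul_mem' := by
    rintro r _ ⟨a, A, hA, rfl⟩
    exact ⟨r * a, r • A, Submodule.smul_mem _ r hA, vecMatrix_smul r a A⟩

instance : Module.Finite ℝ (Matrix Idx Idx K) :=
  inferInstanceAs (Module.Finite ℝ (Idx → Idx → K))

/-- The space of vectors as a type. -/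
def Vec : Type := vecSubmodule K

instance : AddCommGroup (Vec K) := inferInstanceAs (AddCommGroup (vecSubmodule K))

instance : Module ℝ (Vec K) := inferInstanceAs (Module ℝ (vecSubmodule K))

instance : Module.Finite ℝ (Vec K) := inferInstanceAs (Module.Finite ℝ (vecSubmodule K))

variable {K} in
/-- The matrix of a vector. -/
def Vec.mat (M : Vec K) : Matrix Idx Idx K := M.1

variable {K} in
/-- A vector from its matrix. -/
def Vec.mk (M : Matrix Idx Idx K) (hM : M ∈ vecSubmodule K) : Vec K := ⟨M, hM⟩

variable {K} in
theorem Vec.mat_mk (M : Matrix Idx Idx K) (hM : M ∈ vecSubmodule K) : (Vec.mk M hM).mat = M := rfl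

variable {K} in
theorem Vec.mat_mem (M : Vec K) : M.mat ∈ vecSubmodule K := M.2

variable {K} in
theorem Vec.ext {M N : Vec K} (h : M.mat = N.mat) : M = N := Subtype.ext h

variable {K} in
theorem Vec.mat_add (M N : Vec K) : (M + N).mat = M.mat + N.mat := rfl

variable {K} in
theorem Vec.mat_smul (r : ℝ) (M : Vec K) : (r • M).mat = r • M.mat := rfl

/-- The Minkowski metric `h(𝒜, ℬ) = ¼ Re tr (𝒜 ℬ)`; see `minkowski_self`. -/
def minkowski : LinearMap.BilinForm ℝ (Vec K) :=
  LinearMap.mk₂ ℝ (fun M N => (1 / 4 : ℝ) * re (Matrix.trace (M.mat * N.mat)))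
    (fun M M' N => by
      rw [Vec.mat_add, Matrix.add_mul, Matrix.trace_add, map_add, mul_add])
    (fun r M N => by
      rw [Vec.mat_smul, Matrix.smul_mul, Matrix.trace_smul, map_smul, smul_eq_mul,
        smul_eq_mul]
      ring)
    (fun M N N' => by
      rw [Vec.mat_add, Matrix.mul_add, Matrix.trace_add, map_add, mul_add])
    (fun r M N => by
      rw [Vec.mat_smul, Matrix.mul_smul, Matrix.trace_smul, map_smul, smul_eq_mul,
        smul_eq_mul]
      ring)

theorem minkowski_apply (M N : Vec K) :
    minkowski K M N = (1 / 4 : ℝ) * re (Matrix.trace (M.mat * N.mat)) := rfl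

variable {K} in
theorem herm_diag {A : Matrix (Fin 2) (Fin 2) K} (hA : A ∈ herm K) (i : Fin 2) :
    A i i = re (A i i) • (1 : K) := by
  have h : star (A i i) = A i i := congrFun (congrFun hA i) i
  have h2 := NormedDivisionAlgebra.add_star (A i i)
  rw [h, ← two_smul ℝ, mul_smul] at h2
  exact smul_right_injective K (two_ne_zero (α := ℝ)) h2

variable {K} in
theorem herm_off {A : Matrix (Fin 2) (Fin 2) K} (hA : A ∈ herm K) : A 1 0 = star (A 0 1) :=
  (congrFun (congrFun hA 1) 0).symm

variable {K} in
theorem star_mul_comm (a : K) : star a * a = a * star a := by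
  rw [star_eq, sub_mul, mul_sub, smul_mul_assoc, mul_smul_comm, one_mul, mul_one]

variable {K} in
/-- On the diagonal `h(𝒜, 𝒜) = a² + g(A, A)` with `g(A, A) = -det A`. -/
theorem minkowski_self (a : ℝ) (A : Matrix (Fin 2) (Fin 2) K) (hA : A ∈ herm K) :
    minkowski K (.mk (vecMatrix a A) ⟨a, A, hA, rfl⟩) (.mk (vecMatrix a A) ⟨a, A, hA, rfl⟩) =
      a ^ 2 - re (A 0 0 * A 1 1 - A 0 1 * A 1 0) := by
  have h0 := herm_diag hA 0
  have h1 := herm_diag hA 1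
  have h10 := herm_off hA
  have hc := star_mul_comm (A 0 1)
  have e1 : re (1 : K) = 1 := NormedDivisionAlgebra.re_one
  have hA2 : A = !![A 0 0, A 0 1; star (A 0 1), A 1 1] := by
    ext i j
    fin_cases i <;> fin_cases j <;> simp [h10]
  generalize A 0 1 = y at *
  generalize A 0 0 = p at *
  generalize A 1 1 = s at *
  generalize re p = p' at *
  generalize re s = s' at *
  subst h0 h1
  simp only [minkowski_apply, Vec.mat_mk, vecMatrix, Matrix.fromBlocks_multiply,
    Matrix.trace, Fintype.sum_sum_type, Matrix.diag, Matrix.fromBlocks_apply₁₁,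
    Matrix.fromBlocks_apply₂₂]
  rw [h10, hA2]
  simp [Matrix.mul_apply, Fin.sum_univ_two, traceRev, Matrix.trace, hc, sub_mul, mul_sub, mul_add,
    e1]
  ring

variable {K} in
theorem vec_conjTranspose {M : Matrix Idx Idx K} (hM : M ∈ vecSubmodule K) :
    Mᴴ ∈ vecSubmodule K := by
  obtain ⟨a, A, hA, rfl⟩ := hM
  have h0 := herm_diag hA 0
  have h1 := herm_diag hA 1
  have s0 : star (A 0 0) = A 0 0 := congrFun (congrFun hA 0) 0
  have s1 : star (A 1 1) = A 1 1 := congrFun (congrFun hA 1) 1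
  have hA' : Aᴴ = A := hA
  have ht : (traceRev A)ᴴ = traceRev A := by
    rw [traceRev, Matrix.conjTranspose_sub, hA', Matrix.diagonal_conjTranspose]
    congr 2
    funext i
    simp [Matrix.trace, Fin.sum_univ_two, s0, s1]
  refine ⟨a, traceRev A, ht, ?_⟩
  have hs : ((a • 1 : Matrix (Fin 2) (Fin 2) K))ᴴ = a • 1 := by
    ext i j
    rw [Matrix.conjTranspose_apply, Matrix.smul_apply, star_smul', Matrix.smul_apply,
      Matrix.one_apply, Matrix.one_apply]
    by_cases h : i = j
    · simp [h]
    · simp [h, Ne.symm h]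
  rw [vecMatrix, vecMatrix, Matrix.fromBlocks_conjTranspose, hA', ht, Matrix.conjTranspose_neg, hs]
  congr 1
  ext i j
  fin_cases i <;> fin_cases j <;> simp [traceRev, Matrix.trace, Fin.sum_univ_two, two_mul]
    <;> abel

variable {K} in
theorem normSq_nonneg (a : K) : 0 ≤ re (a * star a) := by
  by_cases h : a = 0
  · simp [h]
  · exact (NormedDivisionAlgebra.normSq_pos a h).le

variable {K} in
theorem minkowski_conj_pos (M : Vec K) (hM : M ≠ 0) :
    0 < minkowski K M (.mk M.matᴴ (vec_conjTranspose M.mat_mem)) := by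
  have hexp : minkowski K M (.mk M.matᴴ (vec_conjTranspose M.mat_mem)) =
      (1 / 4 : ℝ) * ∑ i, ∑ j, re (M.mat i j * star (M.mat i j)) := by
    simp only [minkowski_apply, Vec.mat_mk, Matrix.trace, Matrix.diag, Matrix.mul_apply,
      Matrix.conjTranspose_apply, map_sum]
  rw [hexp]
  have hne : ∃ i j, M.mat i j ≠ 0 := by
    by_contra hcon
    push Not at hcon
    exact hM (Vec.ext (Matrix.ext hcon))
  obtain ⟨i, j, hij⟩ := hne
  refine mul_pos (by norm_num) ?_
  refine Finset.sum_pos' (fun i _ => Finset.sum_nonneg fun j _ => normSq_nonneg _)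
    ⟨i, Finset.mem_univ _, ?_⟩
  exact Finset.sum_pos' (fun j _ => normSq_nonneg _)
    ⟨j, Finset.mem_univ _, NormedDivisionAlgebra.normSq_pos _ hij⟩

theorem minkowski_nondegenerate : (minkowski K).Nondegenerate := by
  refine LinearMap.BilinForm.Nondegenerate.ofSeparatingLeft fun M h => ?_
  by_contra hM
  exact (minkowski_conj_pos M hM).ne' (h _)

/-- The spinors `K⁴ = S₊ ⊕ S₋`. -/
abbrev Spinor : Type := Idx → K

/-- The Clifford action of vectors on spinors, `Γ(𝒜) Ψ = 𝒜 Ψ`. -/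
def gamma : Vec K →ₗ[ℝ] Module.End ℝ (Spinor K) :=
  LinearMap.mk₂ ℝ (fun M Ψ => M.mat *ᵥ Ψ)
    (fun M N Ψ => Matrix.add_mulVec M.mat N.mat Ψ)
    (fun r M Ψ => Matrix.smul_mulVec r M.mat Ψ)
    (fun M Ψ Φ => Matrix.mulVec_add M.mat Ψ Φ)
    (fun r M Ψ => Matrix.mulVec_smul M.mat r Ψ)

/-- The matrix `Γ⁰` with blocks `0, -1; 1, 0`. -/
def gammaZero : Matrix Idx Idx K := Matrix.fromBlocks 0 (-1) 1 0

/-- The skew-symmetric form on spinors, `⟨Ψ, Φ⟩ = Re (Ψ† Γ⁰ Φ)`. -/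
def pairing : Spinor K →ₗ[ℝ] Spinor K →ₗ[ℝ] ℝ :=
  LinearMap.mk₂ ℝ (fun Ψ Φ => re (star Ψ ⬝ᵥ (gammaZero K *ᵥ Φ)))
    (fun Ψ Ψ' Φ => by rw [star_add, add_dotProduct, map_add])
    (fun r Ψ Φ => by
      have h : star (r • Ψ) = r • star Ψ := funext fun i => star_smul' r (Ψ i)
      rw [h, smul_dotProduct, map_smul])
    (fun Ψ Φ Φ' => by rw [Matrix.mulVec_add, dotProduct_add, map_add])
    (fun r Ψ Φ => by rw [Matrix.mulVec_smul, dotProduct_smul, map_smul])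

/-- The bracket of spinors: `Ψ · Φ` is the unique vector with `h(Ψ · Φ, 𝒜) = ⟨Ψ, Γ(𝒜) Φ⟩` for all
vectors `𝒜`. -/
def dot : Spinor K →ₗ[ℝ] Spinor K →ₗ[ℝ] Vec K :=
  LinearMap.mk₂ ℝ
    (fun Ψ Φ => ((minkowski K).toDual (minkowski_nondegenerate K)).symm
      (pairing K Ψ ∘ₗ (gamma K).flip Φ))
    (fun Ψ Ψ' Φ => by rw [map_add, LinearMap.add_comp, map_add])
    (fun r Ψ Φ => by rw [map_smul, LinearMap.smul_comp, map_smul])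
    (fun Ψ Φ Φ' => by rw [map_add, LinearMap.comp_add, map_add])
    (fun r Ψ Φ => by rw [map_smul, LinearMap.comp_smul, map_smul])

theorem minkowski_dot (Ψ Φ : Spinor K) (A : Vec K) :
    minkowski K (dot K Ψ Φ) A = pairing K Ψ (gamma K A Φ) :=
  LinearMap.BilinForm.apply_toDual_symm_apply (hB := minkowski_nondegenerate K) _ _

/-- The Lorentz algebra `𝔰𝔬(n+2, 1)`: the endomorphisms of the space of vectors that are
skew-adjoint for the Minkowski metric. -/
abbrev so : Submodule ℝ (Module.End ℝ (Vec K)) := (minkowski K).skewAdjointSubmodule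

/-- The commutator on the Lorentz algebra. -/
def soBracket : so K →ₗ[ℝ] so K →ₗ[ℝ] so K :=
  LinearMap.mk₂ ℝ
    (fun X Y => ⟨⁅X.1, Y.1⁆, LinearMap.BilinForm.isSkewAdjoint_bracket (minkowski K) X.2 Y.2⟩)
    (fun X X' Y => Subtype.ext (by simp only [Submodule.coe_add, Ring.lie_def]; noncomm_ring))
    (fun r X Y => Subtype.ext (by simp [Ring.lie_def, smul_sub]))
    (fun X Y Y' => Subtype.ext (by simp only [Submodule.coe_add, Ring.lie_def]; noncomm_ring))
    (fun r X Y => Subtype.ext (by simp [Ring.lie_def, smul_sub]))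

/-- The spinor representation of the Lorentz algebra, `X ↦ ¼ ∑ Γ(X eᵢ) Γ(eⁱ)` for a basis `eᵢ` of
the vectors and its dual basis `eⁱ` for the Minkowski metric; see `spin_bivector`. -/
def spin : so K →ₗ[ℝ] Module.End ℝ (Spinor K) where
  toFun X := (1 / 4 : ℝ) • ∑ i,
    gamma K (X.1 (Module.finBasis ℝ (Vec K) i)) *
      gamma K ((minkowski K).dualBasis (minkowski_nondegenerate K)
        (Module.finBasis ℝ (Vec K)) i)
  map_add' X Y := by
    rw [← smul_add, ← Finset.sum_add_distrib]
    congr 1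
    refine Finset.sum_congr rfl fun i _ => ?_
    rw [← add_mul, ← map_add]
    rfl
  map_smul' r X := by
    rw [RingHom.id_apply, smul_comm r (1 / 4 : ℝ)]
    congr 1
    rw [Finset.smul_sum]
    apply Finset.sum_congr rfl
    intro i _
    rw [← smul_mul_assoc, ← map_smul]
    rfl

theorem spin_apply (X : so K) : spin K X = (1 / 4 : ℝ) • ∑ i,
    gamma K (X.1 (Module.finBasis ℝ (Vec K) i)) *
      gamma K ((minkowski K).dualBasis (minkowski_nondegenerate K)
        (Module.finBasis ℝ (Vec K)) i) := rfl

/-- The bivector `𝒜 ∧ ℬ` acts on vectors by `𝒞 ↦ h(ℬ, 𝒞) 𝒜 - h(𝒜, 𝒞) ℬ` and on spinors by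
`¼ (Γ(𝒜) Γ(ℬ) - Γ(ℬ) Γ(𝒜))`. -/
theorem spin_bivector (A B : Vec K) (X : so K)
    (hX : ∀ C, X.1 C = minkowski K B C • A - minkowski K A C • B) :
    spin K X = (1 / 4 : ℝ) • (gamma K A * gamma K B - gamma K B * gamma K A) := by
  have key : ∀ D : Vec K, ∑ i, minkowski K D (Module.finBasis ℝ (Vec K) i) •
      (minkowski K).dualBasis (minkowski_nondegenerate K) (Module.finBasis ℝ (Vec K)) i = D := by
    intro D
    have h := ((minkowski K).dualBasis (minkowski_nondegenerate K)
      (Module.finBasis ℝ (Vec K))).sum_repr D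
    simpa only [LinearMap.BilinForm.dualBasis_repr_apply] using h
  rw [spin_apply]
  congr 1
  have hA := congrArg (gamma K) (key A)
  have hB := congrArg (gamma K) (key B)
  rw [map_sum] at hA hB
  rw [← congrArg (gamma K A * ·) hB, ← congrArg (gamma K B * ·) hA]
  simp only [hX, map_sub, map_smul, sub_mul, Finset.mul_sum, Finset.sum_sub_distrib,
    smul_mul_assoc, mul_smul_comm]

end Spacetime

/-! ## Super vector spaces, Lie superalgebras and their cohomology

A super vector space is a real vector space `g` with a decomposition `G 0 ⊕ G 1` into an even and
an odd subspace, indexed by `ZMod 2`. -/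

/-- The sign `(-1)ᵃ`. -/
def sgn (a : ZMod 2) : ℝ := if a = 0 then 1 else -1

/-- The sign `χ(σ; x₁, …, xₙ) = sgn(σ) ε(σ; x₁, …, xₙ)`, where the Koszul sign `ε` gets the factor
`(-1)^(|x||y|)` from each pair of elements whose order is reversed in `x_σ(1) ⋯ x_σ(n)`; it depends
only on the grades `q i = |xᵢ|`. -/
def chi {n : ℕ} (σ : Equiv.Perm (Fin n)) (q : Fin n → ZMod 2) : ℝ :=
  ((Equiv.Perm.sign σ : ℤ) : ℝ) *
    ∏ a, ∏ b, if a < b ∧ σ b < σ a then sgn (q (σ a) * q (σ b)) else 1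

section Super

variable {g R : Type} [AddCommGroup g] [Module ℝ g] [AddCommGroup R] [Module ℝ R]

/-- A Lie superalgebra. -/
structure IsLieSuperalgebra (G : ZMod 2 → Submodule ℝ g) (br : g →ₗ[ℝ] g →ₗ[ℝ] g) : Prop where
  internal : DirectSum.IsInternal G
  bracket_mem : ∀ p q, ∀ x ∈ G p, ∀ y ∈ G q, br x y ∈ G (p + q)
  skew : ∀ p q, ∀ x ∈ G p, ∀ y ∈ G q, br x y = -(sgn (p * q) • br y x)
  jacobi : ∀ p q r, ∀ x ∈ G p, ∀ y ∈ G q, ∀ z ∈ G r,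
    br x (br y z) = br (br x y) z + sgn (p * q) • br y (br x z)

/-- An `n`-cochain of parity `p`: a super-skew-symmetric `n`-linear map `g × ⋯ × g → R` that shifts
the parity by `p`. -/
structure IsCochain (G : ZMod 2 → Submodule ℝ g) (S : ZMod 2 → Submodule ℝ R) (p : ZMod 2) {n : ℕ}
    (ω : MultilinearMap ℝ (fun _ : Fin n => g) R) : Prop where
  parity : ∀ (q : Fin n → ZMod 2) (x : Fin n → g), (∀ i, x i ∈ G (q i)) → ω x ∈ S (p + ∑ i, q i)
  skew : ∀ (q : Fin n → ZMod 2) (x : Fin n → g), (∀ i, x i ∈ G (q i)) →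
    ∀ σ : Equiv.Perm (Fin n), ω (fun i => x (σ i)) = chi σ q • ω x

/-- The value `dω(X₁, …, Xₙ₊₂)` of the Chevalley--Eilenberg coboundary of an `(n+1)`-cochain `ω` of
parity `p` at homogeneous elements `Xᵢ` of parity `q i`, for a bracket `br` and an action `ρ`. In
the double sum, `i < j` and `j.succAbove ∘ i.succAbove` enumerates the indices other than
`i, j` in increasing order. -/
def coboundary (br : g → g → g) (ρ : g → R → R) (p : ZMod 2) {n : ℕ}
    (ω : MultilinearMap ℝ (fun _ : Fin (n + 1) => g) R)
    (q : Fin (n + 2) → ZMod 2) (X : Fin (n + 2) → g) : R :=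
  (∑ i : Fin (n + 2), ((-1 : ℝ) ^ (i : ℕ) * sgn (q i * p) * ∏ a ∈ Finset.Iio i, sgn (q i * q a)) •
      ρ (X i) (ω fun k => X (i.succAbove k))) +
    ∑ j : Fin (n + 2), ∑ i : Fin (n + 1), if i.castSucc < j then
      ((-1 : ℝ) ^ ((i : ℕ) + (j : ℕ)) * sgn (q i.castSucc * q j) *
          (∏ a ∈ Finset.Iio i.castSucc, sgn (q i.castSucc * q a)) *
          ∏ a ∈ Finset.Iio j, sgn (q j * q a)) •
        ω (Fin.cons (br (X i.castSucc) (X j)) fun k => X (j.succAbove (i.succAbove k)))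
    else 0

/-- An even cocycle. -/
def IsEvenCocycle (G : ZMod 2 → Submodule ℝ g) (S : ZMod 2 → Submodule ℝ R)
    (br : g → g → g) (ρ : g → R → R) {n : ℕ}
    (ω : MultilinearMap ℝ (fun _ : Fin (n + 1) => g) R) : Prop :=
  IsCochain G S 0 ω ∧
    ∀ (q : Fin (n + 2) → ZMod 2) (X : Fin (n + 2) → g), (∀ i, X i ∈ G (q i)) →
      coboundary br ρ 0 ω q X = 0

/-- A coboundary: `ω = dθ` for a cochain `θ`, the sum of its even part `θ 0` and its odd part
`θ 1`. -/
def IsCoboundary (G : ZMod 2 → Submodule ℝ g) (S : ZMod 2 → Submodule ℝ R)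
    (br : g → g → g) (ρ : g → R → R) {n : ℕ}
    (ω : MultilinearMap ℝ (fun _ : Fin (n + 2) => g) R) : Prop :=
  ∃ θ : ZMod 2 → MultilinearMap ℝ (fun _ : Fin (n + 1) => g) R,
    (∀ p, IsCochain G S p (θ p)) ∧
    ∀ (q : Fin (n + 2) → ZMod 2) (X : Fin (n + 2) → g), (∀ i, X i ∈ G (q i)) →
      ω X = ∑ p, coboundary br ρ p (θ p) q X

/-- A vector space regarded as a purely even super vector space. -/
def evenGrading (R : Type) [AddCommGroup R] [Module ℝ R] : ZMod 2 → Submodule ℝ R :=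
  fun q => if q = 0 then ⊤ else ⊥

/-- A bilinear map as a multilinear map in two arguments. -/
def toMultilinear (br : g →ₗ[ℝ] g →ₗ[ℝ] g) : MultilinearMap ℝ (fun _ : Fin 2 => g) g where
  toFun x := br (x 0) (x 1)
  map_update_add' x i a b := by fin_cases i <;> simp
  map_update_smul' x i c a := by fin_cases i <;> simp

end Super

/-! ## `L_∞`-superalgebras -/

/-- The data of an `L_∞`-superalgebra on the total space `L`: the bigrading by degree and parity,
and the brackets `l k` (with `l k` the bracket of `k` arguments). -/
structure LInftyData (L : Type) [AddCommGroup L] [Module ℝ L] where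
  grading : ℤ × ZMod 2 → Submodule ℝ L
  l : (k : ℕ) → MultilinearMap ℝ (fun _ : Fin k => L) L

namespace LInftyData

/-- The overall grade: the sum of degree and parity, modulo 2. -/
def grade (d : ℤ × ZMod 2) : ZMod 2 := (d.1 : ZMod 2) + d.2

/-- `σ` is an `(i, m)`-unshuffle. -/
def IsUnshuffle {i m : ℕ} (σ : Equiv.Perm (Fin (i + m))) : Prop :=
  StrictMono (fun a : Fin i => σ (Fin.castAdd m a)) ∧
    StrictMono (fun b : Fin m => σ (Fin.natAdd i b))

variable {L L' L'' : Type} [AddCommGroup L] [Module ℝ L] [AddCommGroup L'] [Module ℝ L']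
  [AddCommGroup L''] [Module ℝ L'']

open Classical in
/-- The part of the generalized Jacobi identity in `n = i + m` arguments with inner bracket `l i`
and outer bracket `l j`, where `j = m + 1`. -/
def jacobiTerm (A : LInftyData L) (i m : ℕ) (d : Fin (i + m) → ℤ × ZMod 2)
    (x : Fin (i + m) → L) : L :=
  ∑ σ : Equiv.Perm (Fin (i + m)), if IsUnshuffle σ then
    (chi σ (fun a => grade (d a)) * (-1 : ℝ) ^ (i * m)) •
      A.l (m + 1) (Fin.cons (A.l i fun a => x (σ (Fin.castAdd m a)))
        fun b => x (σ (Fin.natAdd i b)))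
  else 0

/-- An `L_∞`-superalgebra: the total space is the direct sum of its bihomogeneous parts, which
vanish in negative degree; there is no bracket of zero arguments; `l k` has degree `k - 2` and
preserves parity; it is totally antisymmetric; and the generalized Jacobi identity holds. -/
structure IsLInftySuperalgebra (A : LInftyData L) : Prop where
  internal : DirectSum.IsInternal A.grading
  nonneg : ∀ p q, p < 0 → A.grading (p, q) = ⊥
  l_zero : A.l 0 = 0
  degree : ∀ (k : ℕ) (d : Fin k → ℤ × ZMod 2) (x : Fin k → L), (∀ a, x a ∈ A.grading (d a)) →
    A.l k x ∈ A.grading (∑ a, (d a).1 + ((k : ℤ) - 2), ∑ a, (d a).2)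
  antisymm : ∀ (k : ℕ) (d : Fin k → ℤ × ZMod 2) (x : Fin k → L), (∀ a, x a ∈ A.grading (d a)) →
    ∀ σ : Equiv.Perm (Fin k), A.l k (fun a => x (σ a)) = chi σ (fun a => grade (d a)) • A.l k x
  jacobi : ∀ (n : ℕ) (d : Fin n → ℤ × ZMod 2) (x : Fin n → L), (∀ a, x a ∈ A.grading (d a)) →
    ∑ c : Finset.HasAntidiagonal.antidiagonal n,
      A.jacobiTerm c.1.1 c.1.2 (d ∘ Fin.cast (Finset.HasAntidiagonal.mem_antidiagonal.mp c.2))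
        (x ∘ Fin.cast (Finset.HasAntidiagonal.mem_antidiagonal.mp c.2)) = 0

/-- A Lie `n`-superalgebra: an `L_∞`-superalgebra with nonzero terms only in degrees `< n`. -/
def IsLieNSuperalgebra (n : ℕ) (A : LInftyData L) : Prop :=
  A.IsLInftySuperalgebra ∧ ∀ (p : ℤ) (q : ZMod 2), (n : ℤ) ≤ p → A.grading (p, q) = ⊥

/-- A Lie `(n+1)`-superalgebra is exact if only its terms `V₀` and `Vₙ` are nonzero, `d = l 1`
vanishes, and the `(n+2)`-cocycle `l (n+2)` on the Lie superalgebra `V₀`, with values in the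
representation `Vₙ`, is a coboundary. (A multilinear map on `V₀` is the restriction of one on the
total space.) -/
def IsExact (n : ℕ) (A : LInftyData L) : Prop :=
  (∀ (p : ℤ) (q : ZMod 2), p ≠ 0 → p ≠ n → A.grading (p, q) = ⊥) ∧ A.l 1 = 0 ∧
    IsCoboundary (fun q => A.grading (0, q)) (fun q => A.grading (n, q))
      (fun x y => A.l 2 ![x, y]) (fun x y => A.l 2 ![x, y]) (A.l (n + 2))

/-- A (strict) homomorphism of `L_∞`-superalgebras. -/
def IsHom (A : LInftyData L) (B : LInftyData L') (f : L →ₗ[ℝ] L') : Prop :=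
  (∀ d, ∀ x ∈ A.grading d, f x ∈ B.grading d) ∧ ∀ k x, f (A.l k x) = B.l k fun a => f (x a)

/-- A short exact sequence `0 → A → B → C → 0` of `L_∞`-superalgebras. -/
structure IsShortExact (A : LInftyData L) (B : LInftyData L') (C : LInftyData L'')
    (f : L →ₗ[ℝ] L') (h : L' →ₗ[ℝ] L'') : Prop where
  left : A.IsLInftySuperalgebra
  middle : B.IsLInftySuperalgebra
  right : C.IsLInftySuperalgebra
  hom_left : A.IsHom B f
  hom_right : B.IsHom C h
  injective : Function.Injective f
  exact : Function.Exact f h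
  surjective : Function.Surjective h

/-- A Lie superalgebra as an `L_∞`-superalgebra concentrated in degree `0`. -/
def ofLie (G : ZMod 2 → Submodule ℝ L) (br : L →ₗ[ℝ] L →ₗ[ℝ] L) : LInftyData L where
  grading d := if d.1 = 0 then G d.2 else ⊥
  l
    | 2 => toMultilinear br
    | _ => 0

/-- The abelian `L_∞`-superalgebra `b²ℝ`, with `ℝ` in degree `2` and even parity. -/
def bTwoR : LInftyData ℝ where
  grading d := if d = (2, 0) then ⊤ else ⊥
  l _ := 0

/-- The extension of a Lie superalgebra `L` by a `4`-cochain `ω` with values in the trivial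
representation `ℝ`: the total space is `L ⊕ ℝ`, with `L` in degree `0` and `ℝ` in degree `2` and
even parity; `l 2` is the bracket of `L` (and zero on `ℝ`), `l 4` is `ω`, and all the others
vanish. -/
def extension (G : ZMod 2 → Submodule ℝ L) (br : L →ₗ[ℝ] L →ₗ[ℝ] L)
    (ω : MultilinearMap ℝ (fun _ : Fin 4 => L) ℝ) : LInftyData (L × ℝ) where
  grading d :=
    if d.1 = 0 then (G d.2).prod ⊥ else if d = (2, 0) then Submodule.prod ⊥ ⊤ else ⊥
  l
    | 2 => (LinearMap.inl ℝ L ℝ).compMultilinearMap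
        ((toMultilinear br).compLinearMap fun _ => LinearMap.fst ℝ L ℝ)
    | 4 => (LinearMap.inr ℝ L ℝ).compMultilinearMap
        (ω.compLinearMap fun _ => LinearMap.fst ℝ L ℝ)
    | _ => 0

end LInftyData

/-! ## The Poincaré superalgebra and the cocycle `β` -/

section Poincare

variable (K : Type) [NormedDivisionAlgebra K]

/-- The supertranslation algebra `T`, with even part the vectors and odd part the spinors. -/
abbrev T : Type := Vec K × Spinor K

/-- The bracket of `T`: that of two spinors is `Ψ · Φ`, all others vanish. -/
def tBracket : T K →ₗ[ℝ] T K →ₗ[ℝ] T K :=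
  ((dot K).compl₁₂ (LinearMap.snd ℝ (Vec K) (Spinor K)) (LinearMap.snd ℝ (Vec K) (Spinor K))).compr₂
    (LinearMap.inl ℝ (Vec K) (Spinor K))

/-- The action of the Lorentz algebra on `T`. -/
def soAction : so K →ₗ[ℝ] T K →ₗ[ℝ] T K :=
  LinearMap.mk₂ ℝ (fun X t => (X.1 t.1, spin K X t.2))
    (fun X Y t => by simp)
    (fun r X t => by simp)
    (fun X t s => by simp)
    (fun r X t => by simp)

/-- The underlying space of the Poincaré superalgebra `𝔰𝔦𝔰𝔬(n+2, 1) = 𝔰𝔬(n+2, 1) ⋉ T`. -/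
abbrev Siso : Type := so K × T K

/-- The even part is `𝔰𝔬(n+2, 1) ⊕ V`, the odd part consists of the spinors. -/
def sisoGrading : ZMod 2 → Submodule ℝ (Siso K) :=
  fun q => if q = 0 then Submodule.prod ⊤ (Submodule.prod ⊤ ⊥)
    else Submodule.prod ⊥ (Submodule.prod ⊥ ⊤)

/-- The bracket of the semidirect product,
`[(X, t), (Y, s)] = ([X, Y], X s - Y t + [t, s])`. -/
def sisoBracket : Siso K →ₗ[ℝ] Siso K →ₗ[ℝ] Siso K :=
  LinearMap.mk₂ ℝ
    (fun x y => (soBracket K x.1 y.1,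
      soAction K x.1 y.2 - soAction K y.1 x.2 + tBracket K x.2 y.2))
    (fun x x' y => by ext1 <;> simp only [Prod.fst_add, Prod.snd_add, map_add,
      LinearMap.add_apply]; abel)
    (fun r x y => by ext1 <;> simp only [Prod.smul_fst, Prod.smul_snd, map_smul,
      LinearMap.smul_apply, smul_add, smul_sub])
    (fun x y y' => by ext1 <;> simp only [Prod.fst_add, Prod.snd_add, map_add,
      LinearMap.add_apply]; abel)
    (fun r x y => by ext1 <;> simp only [Prod.smul_fst, Prod.smul_snd, map_smul,
      LinearMap.smul_apply, smul_add, smul_sub])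

/-- The map `(t₀, t₁, t₂, t₃) ↦ ⟨Ψ₀, (𝒜₂ 𝒜₃ - 𝒜₃ 𝒜₂) Ψ₁⟩`, where `tᵢ = (𝒜ᵢ, Ψᵢ)` and the
commutator is that of the Clifford action. -/
def betaAux : MultilinearMap ℝ (fun _ : Fin 4 => T K) ℝ where
  toFun t := pairing K (t 0).2
    ((gamma K (t 2).1 * gamma K (t 3).1 - gamma K (t 3).1 * gamma K (t 2).1) (t 1).2)
  map_update_add' {inst} t i a b := by
    obtain rfl : inst = instDecidableEqFin 4 := Subsingleton.elim _ _
    fin_cases i <;> simp [add_mul, mul_add] <;> ring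
  map_update_smul' {inst} t i c a := by
    obtain rfl : inst = instDecidableEqFin 4 := Subsingleton.elim _ _
    fin_cases i <;> simp <;> ring

open Classical in
/-- The `(2,2)`-form `β` on `T` with `β(Ψ, Φ, 𝒜, ℬ) = ⟨Ψ, (𝒜 ℬ - ℬ 𝒜) Φ⟩`, extended to arguments in
any order by super-skew-symmetry: the sum over the `(2,2)`-unshuffles `σ` of
`sgn(σ) ⟨Ψ_σ(0), [𝒜_σ(2), 𝒜_σ(3)] Ψ_σ(1)⟩`. -/
def beta : MultilinearMap ℝ (fun _ : Fin 4 => T K) ℝ :=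
  ∑ σ : Equiv.Perm (Fin 4), if LInftyData.IsUnshuffle (i := 2) (m := 2) σ then
    ((Equiv.Perm.sign σ : ℤ) : ℝ) • (betaAux K).domDomCongr σ else 0

theorem unshuffle_aux : ∀ σ : Equiv.Perm (Fin 4),
    (σ 0 < σ 1 ∧ σ 2 < σ 3) → σ ≠ 1 → (σ 0 = 2 ∨ σ 0 = 3 ∨ σ 1 = 2 ∨ σ 1 = 3) := by
  decide

theorem beta_apply (Ψ Φ : Spinor K) (A B : Vec K) :
    beta K ![(0, Ψ), (0, Φ), (A, 0), (B, 0)] =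
      pairing K Ψ ((gamma K A * gamma K B - gamma K B * gamma K A) Φ) := by
  classical
  rw [beta, _root_.sum_apply, Finset.sum_eq_single 1]
  · rw [if_pos ⟨fun a b h => h, fun a b h => Nat.add_lt_add_left h 2⟩]
    simp [betaAux]
  · intro σ _ hσ
    split_ifs with h
    · have h1 : σ 0 < σ 1 := h.1 (show (0 : Fin 2) < 1 by decide)
      have h2 : σ 2 < σ 3 := h.2 (show (0 : Fin 2) < 1 by decide)
      rcases unshuffle_aux σ ⟨h1, h2⟩ hσ with h | h | h | h <;> simp [betaAux, h]
    · rfl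
  · intro h
    exact absurd (Finset.mem_univ _) h

/-- The extension of `β` to the Poincaré superalgebra that vanishes on `𝔰𝔬(n+2, 1)`. -/
def betaSiso : MultilinearMap ℝ (fun _ : Fin 4 => Siso K) ℝ :=
  (beta K).compLinearMap fun _ => LinearMap.snd ℝ (so K) (T K)

/-- The 2-brane Lie 3-superalgebra `2-brane(n+2, 1)`. -/
def twoBrane : LInftyData (Siso K × ℝ) :=
  LInftyData.extension (sisoGrading K) (sisoBracket K) (betaSiso K)

end Poincare

end Brane

end

open Brane

/-!
A normed division algebra is a composition algebra. The composition identities make the action of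
the vectors on the spinors a Clifford action, with no associativity needed, and yield
`⟨Ψ, (Γ(Ψ·Ψ) Γ(𝒜) - Γ(𝒜) Γ(Ψ·Ψ)) Ψ⟩ = 0`. Polarising this quartic identity gives the cocycle
identity on four spinors and one vector; on the remaining arguments the cocycle condition says that
`β` is Lorentz invariant and skew.

Summed over unshuffles, the terms of the generalised Jacobi identity whose inner bracket is `l₂` are
the Chevalley–Eilenberg coboundary of the outer bracket. For the extension the identity therefore
splits into the Jacobi identity of the Lie superalgebra, the cocycle condition on `β`, and terms
nesting two brackets `l₄`, which vanish because `l₄` takes values in `ℝ`. Finally, a coboundary with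
trivial coefficients vanishes on pairwise commuting elements, while `β` does not vanish on the
commuting elements given by a suitable pair of vectors and a suitable pair of spinors.
-/

namespace Brane

open Brane.NormedDivisionAlgebra (re)

/-! ## Composition identities -/

section Composition

variable {K : Type} [NormedDivisionAlgebra K]

theorem re_star (a : K) : re (star a) = re a := by
  have h := congrArg re (NormedDivisionAlgebra.add_star a)
  rw [map_add, map_smul, NormedDivisionAlgebra.re_one, smul_eq_mul, mul_one] at h
  linarith

/-- The inner product `Re (a b*)` on a normed division algebra; its quadratic form is `|a|²`. -/
noncomputable def innerForm : LinearMap.BilinForm ℝ K :=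
  LinearMap.mk₂ ℝ (fun a b => re (a * star b))
    (fun a a' b => by rw [add_mul, map_add])
    (fun r a b => by rw [smul_mul_assoc, map_smul])
    (fun a b b' => by rw [star_add, mul_add, map_add])
    (fun r a b => by rw [star_smul', mul_smul_comm, map_smul])

theorem innerForm_apply (a b : K) : innerForm a b = re (a * star b) := rfl

theorem innerForm_comm (a b : K) : innerForm a b = innerForm b a := by
  rw [innerForm_apply, innerForm_apply, ← re_star, star_mul, star_star]

theorem innerForm_one_right (a : K) : innerForm a 1 = re a := by
  rw [innerForm_apply, star_one, mul_one]

theorem innerForm_self_pos {a : K} (ha : a ≠ 0) : 0 < innerForm a a :=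
  NormedDivisionAlgebra.normSq_pos a ha

theorem innerForm_mul_mul_self (a b : K) :
    innerForm (a * b) (a * b) = innerForm a a * innerForm b b :=
  NormedDivisionAlgebra.normSq_mul a b

theorem ext_innerForm {a b : K} (h : ∀ c, innerForm a c = innerForm b c) : a = b := by
  by_contra hne
  have := innerForm_self_pos (sub_ne_zero.mpr hne)
  rw [LinearMap.map_sub₂, h, sub_self] at this
  exact this.ne' rfl

theorem innerForm_mul_mul_left (a b c : K) :
    innerForm (a * b) (a * c) = innerForm a a * innerForm b c := by
  have h := innerForm_mul_mul_self a (b + c)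
  simp only [mul_add, map_add, LinearMap.add_apply, innerForm_mul_mul_self] at h
  linear_combination (1 / 2) * h + (1 / 2) * innerForm_comm (a * b) (a * c) -
    (1 / 2) * innerForm a a * innerForm_comm b c

theorem innerForm_mul_mul_exchange (a b c d : K) :
    innerForm (a * b) (c * d) + innerForm (a * d) (c * b) =
      2 * innerForm a c * innerForm b d := by
  have h := innerForm_mul_mul_left (a + c) b d
  simp only [add_mul, map_add, LinearMap.add_apply, innerForm_mul_mul_left] at h
  linear_combination h - innerForm_comm (c * b) (a * d) - innerForm b d * innerForm_comm a c

theorem innerForm_mul_left (a b c : K) : innerForm (a * b) c = innerForm b (star a * c) := by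
  have h := innerForm_mul_mul_exchange a b 1 c
  rw [one_mul, one_mul, innerForm_one_right] at h
  rw [star_eq, sub_mul, smul_mul_assoc, one_mul, map_sub, map_smul, smul_eq_mul,
    innerForm_comm b (a * c)]
  linear_combination h

theorem innerForm_mul_right (a b c : K) : innerForm (a * b) c = innerForm a (c * star b) := by
  have h := innerForm_mul_mul_exchange a b c 1
  rw [mul_one, mul_one, innerForm_one_right] at h
  rw [star_eq b, mul_sub, mul_smul_comm, mul_one, map_sub, map_smul, smul_eq_mul]
  linear_combination h

theorem innerForm_star_star (a b : K) : innerForm (star a) (star b) = innerForm a b := by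
  have h := innerForm_mul_left a 1 b
  rw [mul_one, innerForm_comm 1, innerForm_one_right] at h
  rw [h, innerForm_apply, star_star]

theorem re_mul (a b : K) : re (a * b) = innerForm (star a) b := by
  rw [← star_star b, ← innerForm_apply, innerForm_star_star, ← innerForm_star_star, star_star]

theorem re_mul_comm (a b : K) : re (a * b) = re (b * a) := by
  rw [re_mul, re_mul, ← innerForm_star_star, star_star, innerForm_comm]

theorem star_mul_mul_cancel (a b : K) : star a * (a * b) = innerForm a a • b :=
  ext_innerForm fun c => by
    rw [innerForm_comm, ← innerForm_mul_left, innerForm_mul_mul_left, map_smul,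
      LinearMap.smul_apply, smul_eq_mul, innerForm_comm b]

theorem mul_star_mul_cancel (a b : K) : a * (star a * b) = innerForm a a • b := by
  simpa only [star_star, innerForm_star_star] using star_mul_mul_cancel (star a) b

theorem mul_mul_star_cancel (a b : K) : (b * a) * star a = innerForm a a • b := by
  have h := congrArg star (mul_star_mul_cancel a (star b))
  rwa [star_mul, star_mul, star_star, star_star, star_smul', star_star] at h

theorem mul_star_mul_cancel_right (a b : K) : (b * star a) * a = innerForm a a • b := by
  simpa only [star_star, innerForm_star_star] using mul_mul_star_cancel (star a) b

/-- The right-hand side is `(x * (y * z)) * x`, so this is the middle Moufang identity. -/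
theorem mul_mul_mul_eq_moufang (x y z : K) :
    (x * y) * (z * x) =
      (2 * innerForm (star x) (y * z)) • x - innerForm x x • star (y * z) :=
  ext_innerForm fun t => by
    have h := innerForm_mul_mul_exchange x y t (star (z * x))
    rw [star_mul, mul_star_mul_cancel, innerForm_comm y, innerForm_mul_right (star x), star_star,
      LinearMap.map_smul₂, smul_eq_mul, innerForm_comm (star z), innerForm_mul_right t,
      innerForm_comm t] at h
    rw [innerForm_mul_right (x * y), star_mul, LinearMap.map_sub₂, LinearMap.map_smul₂,
      LinearMap.map_smul₂, smul_eq_mul, smul_eq_mul, star_mul]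
    linear_combination h

theorem innerForm_mul_star_mul_self (a b c : K) :
    innerForm (a * star b * c) a = innerForm a a * innerForm c b := by
  rw [innerForm_mul_left, star_mul, star_star, mul_star_mul_cancel_right, map_smul, smul_eq_mul]

theorem innerForm_mul_star_mul_mul (a b c z : K) :
    innerForm (a * star b * c) (z * b) =
      2 * innerForm b (star z * a) * innerForm c b - innerForm b b * innerForm c (star z * a) := by
  rw [innerForm_mul_left, star_mul, star_star, mul_mul_mul_eq_moufang, map_sub, map_smul, map_smul,
    smul_eq_mul, smul_eq_mul, ← innerForm_star_star (star b), star_star, star_mul, star_star]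

end Composition

/-! ## Dual bases and the spinor representation -/

section DualBasis

variable {k V W ι : Type*} [Field k] [AddCommGroup V] [Module k V] [AddCommGroup W] [Module k W]
  [Fintype ι] [DecidableEq ι] {B : LinearMap.BilinForm k V} (hB : B.Nondegenerate)
  (b : Module.Basis ι k V)

theorem sum_smul_dualBasis (v : V) : ∑ i, B v (b i) • B.dualBasis hB b i = v := by
  simpa only [LinearMap.BilinForm.dualBasis_repr_apply] using (B.dualBasis hB b).sum_repr v

theorem sum_dualBasis_smul (hsymm : B.IsSymm) (v : V) :
    ∑ i, B (B.dualBasis hB b i) v • b i = v := by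
  have h := sum_smul_dualBasis hB (B.dualBasis hB b) v
  rw [LinearMap.BilinForm.dualBasis_dualBasis hB hsymm] at h
  simpa only [hsymm.eq] using h

theorem sum_apply_dualBasis_comm (hsymm : B.IsSymm) (F : V →ₗ[k] V →ₗ[k] W) :
    ∑ i, F (B.dualBasis hB b i) (b i) = ∑ i, F (b i) (B.dualBasis hB b i) := by
  have expand : ∀ i, b i = ∑ j, B (b i) (b j) • B.dualBasis hB b j := fun i =>
    (sum_smul_dualBasis hB b (b i)).symm
  calc ∑ i, F (B.dualBasis hB b i) (b i)
      = ∑ i, ∑ j, B (b i) (b j) • F (B.dualBasis hB b i) (B.dualBasis hB b j) := by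
        refine Finset.sum_congr rfl fun i _ => ?_
        conv_lhs => rw [expand i]
        simp only [map_sum, map_smul]
    _ = ∑ j, ∑ i, B (b j) (b i) • F (B.dualBasis hB b i) (B.dualBasis hB b j) := by
        rw [Finset.sum_comm]
        simp only [hsymm.eq (b _) (b _)]
    _ = ∑ j, F (b j) (B.dualBasis hB b j) := by
        refine Finset.sum_congr rfl fun j _ => ?_
        conv_rhs => rw [expand j]
        simp only [map_sum, map_smul, LinearMap.sum_apply, LinearMap.smul_apply]

theorem sum_apply_dualBasis_skew (hsymm : B.IsSymm) (F : V →ₗ[k] V →ₗ[k] W) {X : Module.End k V}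
    (hX : ∀ v w, B (X v) w = -B v (X w)) :
    ∑ i, F (b i) (X (B.dualBasis hB b i)) = -∑ i, F (X (b i)) (B.dualBasis hB b i) := by
  have expand_left : ∀ j, F (X (b j)) (B.dualBasis hB b j) =
      ∑ i, B (B.dualBasis hB b i) (X (b j)) • F (b i) (B.dualBasis hB b j) := fun j => by
    conv_lhs => rw [← sum_dualBasis_smul hB b hsymm (X (b j))]
    simp only [map_sum, map_smul, LinearMap.sum_apply, LinearMap.smul_apply]
  have expand_right : ∀ i, F (b i) (X (B.dualBasis hB b i)) =
      ∑ j, B (X (B.dualBasis hB b i)) (b j) • F (b i) (B.dualBasis hB b j) := fun i => by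
    conv_lhs => rw [← sum_smul_dualBasis hB b (X (B.dualBasis hB b i))]
    simp only [map_sum, map_smul]
  simp only [expand_left, expand_right, hX, neg_smul, Finset.sum_neg_distrib]
  rw [Finset.sum_comm]

end DualBasis

section Clifford

variable {k V A ι : Type*} [Field k] [AddCommGroup V] [Module k V] [Ring A] [Algebra k A]
  [Fintype ι] [DecidableEq ι] {B : LinearMap.BilinForm k V} (hB : B.Nondegenerate)
  (b : Module.Basis ι k V) {γ : V →ₗ[k] A}

theorem lie_mul_leibniz {R : Type*} [Ring R] (x y z : R) :
    ⁅x, y * z⁆ = ⁅x, y⁆ * z + y * ⁅x, z⁆ := by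
  simp only [Ring.lie_def]
  noncomm_ring

/-- The spinor representation `X ↦ ¼ ∑ᵢ γ(X eᵢ) γ(eⁱ)` attached to a Clifford map `γ`, for a basis
`eᵢ` and its dual basis `eⁱ`. It is a representation only of the skew-adjoint endomorphisms, see
`lie_spinRep_spinRep`. -/
noncomputable def spinRep (γ : V →ₗ[k] A) (X : Module.End k V) : A :=
  (1 / 4 : k) • ∑ i, γ (X (b i)) * γ (B.dualBasis hB b i)

theorem lie_mul_of_clifford (hγ : ∀ v w, γ v * γ w + γ w * γ v = (2 * B v w) • (1 : A))
    (u v w : V) : ⁅γ u * γ v, γ w⁆ = (2 * B v w) • γ u - (2 * B w u) • γ v := by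
  have h : ⁅γ u * γ v, γ w⁆ =
      γ u * (γ v * γ w + γ w * γ v) - (γ w * γ u + γ u * γ w) * γ v := by
    rw [Ring.lie_def]
    noncomm_ring
  rw [h, hγ, hγ, mul_smul_comm, smul_mul_assoc, mul_one, one_mul]

theorem lie_spinRep_clifford [NeZero (2 : k)]
    (hγ : ∀ v w, γ v * γ w + γ w * γ v = (2 * B v w) • (1 : A))
    (hsymm : B.IsSymm) {X : Module.End k V} (hX : ∀ v w, B (X v) w = -B v (X w)) (v : V) :
    ⁅spinRep hB b γ X, γ v⁆ = γ (X v) := by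
  have first : ∑ i, (2 * B (B.dualBasis hB b i) v) • γ (X (b i)) = (2 : k) • γ (X v) := by
    conv_rhs => rw [← sum_dualBasis_smul hB b hsymm v]
    simp only [map_sum, map_smul, Finset.smul_sum, smul_smul]
  have second : ∑ i, (2 * B v (X (b i))) • γ (B.dualBasis hB b i) = -((2 : k) • γ (X v)) := by
    have h : ∀ i, B v (X (b i)) = -B (X v) (b i) := fun i => by rw [hX, neg_neg]
    conv_rhs => rw [← sum_smul_dualBasis hB b (X v)]
    simp only [h, map_sum, map_smul, Finset.smul_sum, smul_smul, mul_neg, neg_smul,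
      Finset.sum_neg_distrib]
  have expand : ⁅spinRep hB b γ X, γ v⁆ =
      (1 / 4 : k) • ∑ i, ⁅γ (X (b i)) * γ (B.dualBasis hB b i), γ v⁆ := by
    simp only [spinRep, Ring.lie_def, Finset.sum_mul, Finset.mul_sum, Finset.sum_sub_distrib,
      smul_mul_assoc, mul_smul_comm, smul_sub]
  have four : (1 / 4 : k) * (2 * 2) = 1 := by
    rw [show (4 : k) = 2 * 2 by norm_num, one_div_mul_cancel (mul_self_ne_zero.mpr two_ne_zero)]
  rw [expand]
  simp only [lie_mul_of_clifford hγ, Finset.sum_sub_distrib, first, second]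
  rw [sub_neg_eq_add, ← two_smul k, smul_smul, smul_smul, mul_assoc, four, one_smul]

theorem lie_spinRep_spinRep [NeZero (2 : k)]
    (hγ : ∀ v w, γ v * γ w + γ w * γ v = (2 * B v w) • (1 : A))
    (hsymm : B.IsSymm) {X : Module.End k V} (hX : ∀ v w, B (X v) w = -B v (X w))
    (Y : Module.End k V) :
    ⁅spinRep hB b γ X, spinRep hB b γ Y⁆ = spinRep hB b γ ⁅X, Y⁆ := by
  have move : ∑ i, γ (Y (b i)) * γ (X (B.dualBasis hB b i)) =
      -∑ i, γ (Y (X (b i))) * γ (B.dualBasis hB b i) :=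
    sum_apply_dualBasis_skew hB b hsymm ((LinearMap.mul k A).compl₁₂ (γ ∘ₗ Y) γ) hX
  calc ⁅spinRep hB b γ X, spinRep hB b γ Y⁆
      = (1 / 4 : k) • ∑ i, ⁅spinRep hB b γ X, γ (Y (b i)) * γ (B.dualBasis hB b i)⁆ := by
        rw [Ring.lie_def, spinRep.eq_1 hB b γ Y, mul_smul_comm, smul_mul_assoc, ← smul_sub,
          Finset.mul_sum, Finset.sum_mul, ← Finset.sum_sub_distrib]
        simp only [← Ring.lie_def]
    _ = (1 / 4 : k) • (∑ i, γ (X (Y (b i))) * γ (B.dualBasis hB b i) +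
          ∑ i, γ (Y (b i)) * γ (X (B.dualBasis hB b i))) := by
        simp only [lie_mul_leibniz, lie_spinRep_clifford hB b hγ hsymm hX, Finset.sum_add_distrib]
    _ = spinRep hB b γ ⁅X, Y⁆ := by
        rw [move, ← sub_eq_add_neg, ← Finset.sum_sub_distrib]
        simp only [spinRep, Ring.lie_def, LinearMap.sub_apply, Module.End.mul_apply, map_sub,
          sub_mul]

theorem spinRep_skew {S : Type*} [AddCommGroup S] [Module k S] {γ : V →ₗ[k] Module.End k S}
    {P : LinearMap.BilinForm k S} (hP : ∀ v x y, P (γ v x) y = -P x (γ v y))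
    (hsymm : B.IsSymm) {X : Module.End k V} (hX : ∀ v w, B (X v) w = -B v (X w)) (x y : S) :
    P (spinRep hB b γ X x) y = -P x (spinRep hB b γ X y) := by
  have reversed : ∑ i, γ (B.dualBasis hB b i) * γ (X (b i)) =
      -∑ i, γ (X (b i)) * γ (B.dualBasis hB b i) :=
    (sum_apply_dualBasis_comm hB b hsymm
      ((LinearMap.mul k (Module.End k S)).compl₁₂ γ (γ ∘ₗ X))).trans
    (sum_apply_dualBasis_skew hB b hsymm ((LinearMap.mul k (Module.End k S)).compl₁₂ γ γ) hX)
  calc P (spinRep hB b γ X x) y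
      = (1 / 4 : k) • P x ((∑ i, γ (B.dualBasis hB b i) * γ (X (b i))) y) := by
        simp only [spinRep, LinearMap.smul_apply, map_smul, LinearMap.sum_apply, map_sum,
          Module.End.mul_apply, hP, neg_neg]
    _ = -P x (spinRep hB b γ X y) := by
        rw [reversed, spinRep, LinearMap.neg_apply, map_neg, LinearMap.smul_apply, map_smul,
          smul_neg]

end Clifford

/-! ## The Clifford action -/

section CliffordAction

variable {K : Type} [NormedDivisionAlgebra K]

theorem mem_herm_of (p s : ℝ) (y : K) : !![p • 1, y; star y, s • 1] ∈ herm K := by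
  change (_ : Matrix (Fin 2) (Fin 2) K)ᴴ = _
  ext i j
  fin_cases i <;> fin_cases j <;> simp [star_smul']

/-- Coordinates on the space of vectors: the vector with blocks `a, Ã; A, -a`, where `A` has the
rows `p, y` and `y*, s`. -/
noncomputable def vec (a p s : ℝ) (y : K) : Vec K :=
  .mk (vecMatrix a !![p • 1, y; star y, s • 1]) ⟨a, _, mem_herm_of p s y, rfl⟩

theorem vec_mat (a p s : ℝ) (y : K) :
    (vec a p s y).mat = vecMatrix a !![p • 1, y; star y, s • 1] := rfl

theorem exists_eq_vec (M : Vec K) : ∃ a p s y, M = vec a p s y := by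
  obtain ⟨a, A, hA, h⟩ := M.mat_mem
  refine ⟨a, re (A 0 0), re (A 1 1), A 0 1, Vec.ext ?_⟩
  rw [h, vec_mat]
  congr 1
  ext i j
  fin_cases i <;> fin_cases j <;> simp [← herm_diag hA, herm_off hA]

theorem vec_add (a p s a' p' s' : ℝ) (y y' : K) :
    vec a p s y + vec a' p' s' y' = vec (a + a') (p + p') (s + s') (y + y') := by
  refine Vec.ext ?_
  rw [Vec.mat_add, vec_mat, vec_mat, vec_mat, vecMatrix_add]
  congr 1
  ext i j
  fin_cases i <;> fin_cases j <;> simp [add_smul]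

theorem vec_smul (r a p s : ℝ) (y : K) :
    r • vec a p s y = vec (r * a) (r * p) (r * s) (r • y) := by
  refine Vec.ext ?_
  rw [Vec.mat_smul, vec_mat, vec_mat, vecMatrix_smul]
  congr 1
  ext i j
  fin_cases i <;> fin_cases j <;> simp [mul_smul, star_smul']

theorem minkowski_comm (A B : Vec K) : minkowski K A B = minkowski K B A := by
  simp only [minkowski_apply, Matrix.trace, Matrix.diag, Matrix.mul_apply, map_sum]
  rw [Finset.sum_comm]
  simp only [re_mul_comm (A.mat _ _)]

theorem minkowski_isSymm : (minkowski K).IsSymm := ⟨minkowski_comm⟩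

theorem ext_minkowski {A B : Vec K} (h : ∀ C, minkowski K A C = minkowski K B C) : A = B :=
  ((minkowski K).toDual (minkowski_nondegenerate K)).injective (LinearMap.ext h)

theorem minkowski_vec_self (a p s : ℝ) (y : K) :
    minkowski K (vec a p s y) (vec a p s y) = a ^ 2 - p * s + innerForm y y := by
  rw [vec, minkowski_self _ _ (mem_herm_of p s y)]
  simp [innerForm_apply, NormedDivisionAlgebra.re_one]
  ring

theorem minkowski_vec (a p s a' p' s' : ℝ) (y y' : K) :
    minkowski K (vec a p s y) (vec a' p' s' y') =
      a * a' - (p * s' + p' * s) / 2 + innerForm y y' := by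
  have h := minkowski_vec_self (a + a') (p + p') (s + s') (y + y')
  simp only [← vec_add, map_add, LinearMap.add_apply, minkowski_vec_self] at h
  rw [minkowski_comm (vec a' p' s' y'), innerForm_comm y' y] at h
  linear_combination (1 / 2) * h

theorem gamma_vec (a p s : ℝ) (y : K) (Ψ : Spinor K) :
    gamma K (vec a p s y) Ψ =
      Sum.elim
        ![a • Ψ (.inl 0) - s • Ψ (.inr 0) + y * Ψ (.inr 1),
          a • Ψ (.inl 1) + star y * Ψ (.inr 0) - p • Ψ (.inr 1)]
        ![p • Ψ (.inl 0) + y * Ψ (.inl 1) - a • Ψ (.inr 0),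
          star y * Ψ (.inl 0) + s • Ψ (.inl 1) - a • Ψ (.inr 1)] := by
  change (vec a p s y).mat *ᵥ Ψ = _
  ext i
  rcases i with i | i <;> fin_cases i <;>
    simp [vec_mat, vecMatrix, traceRev, Matrix.mulVec, dotProduct, Matrix.trace,
      Fin.sum_univ_two, Matrix.one_apply] <;> abel

theorem pairing_eq (Ψ Φ : Spinor K) :
    pairing K Ψ Φ = innerForm (Ψ (.inr 0)) (Φ (.inl 0)) + innerForm (Ψ (.inr 1)) (Φ (.inl 1)) -
      innerForm (Ψ (.inl 0)) (Φ (.inr 0)) - innerForm (Ψ (.inl 1)) (Φ (.inr 1)) := by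
  change re (star Ψ ⬝ᵥ (gammaZero K *ᵥ Φ)) = _
  simp [gammaZero, Matrix.mulVec, dotProduct, Fin.sum_univ_two, Matrix.one_apply, re_mul]
  ring

theorem pairing_skew (Ψ Φ : Spinor K) : pairing K Ψ Φ = -pairing K Φ Ψ := by
  simp only [pairing_eq, innerForm_comm (Φ _)]
  ring

theorem pairing_gamma_comm (A : Vec K) (Ψ Φ : Spinor K) :
    pairing K Ψ (gamma K A Φ) = pairing K Φ (gamma K A Ψ) := by
  obtain ⟨a, p, s, y, rfl⟩ := exists_eq_vec A
  have h : ∀ b c : K, innerForm c (y * b) = innerForm b (star y * c) := fun b c => by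
    rw [innerForm_comm, innerForm_mul_left]
  simp only [pairing_eq, gamma_vec, Sum.elim_inl, Sum.elim_inr, Matrix.cons_val_zero,
    Matrix.cons_val_one, map_add, map_sub, map_smul, smul_eq_mul, h, innerForm_comm (Φ _) (Ψ _)]
  ring

theorem pairing_gamma_left (A : Vec K) (Ψ Φ : Spinor K) :
    pairing K (gamma K A Ψ) Φ = -pairing K Ψ (gamma K A Φ) := by
  rw [pairing_skew, pairing_gamma_comm]

theorem gamma_mul_self (A : Vec K) : gamma K A * gamma K A = minkowski K A A • 1 := by
  obtain ⟨a, p, s, y, rfl⟩ := exists_eq_vec A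
  refine LinearMap.ext fun Ψ => funext fun i => ?_
  rw [Module.End.mul_apply, minkowski_vec, gamma_vec, gamma_vec]
  rcases i with i | i <;> fin_cases i <;>
    simp [mul_add, mul_sub, mul_smul_comm, mul_star_mul_cancel, star_mul_mul_cancel] <;> module

theorem gamma_mul_add_mul_gamma (A B : Vec K) :
    gamma K A * gamma K B + gamma K B * gamma K A = (2 * minkowski K A B) • 1 := by
  have h := gamma_mul_self (A + B)
  simp only [map_add, LinearMap.add_apply, add_mul, mul_add, gamma_mul_self] at h
  rw [minkowski_comm B A] at h
  rw [← sub_eq_zero] at h ⊢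
  rw [← h]
  module

theorem so_skew (X : so K) (A B : Vec K) :
    minkowski K (X.1 A) B = -minkowski K A (X.1 B) := by
  simpa only [Pi.neg_apply, map_neg] using
    (LinearMap.mem_skewAdjointSubmodule _).mp X.2 A B

theorem spin_eq_spinRep (X : so K) :
    spin K X =
      spinRep (minkowski_nondegenerate K) (Module.finBasis ℝ (Vec K)) (gamma K) X.1 := rfl

theorem lie_spin_gamma (X : so K) (A : Vec K) : ⁅spin K X, gamma K A⁆ = gamma K (X.1 A) :=
  lie_spinRep_clifford _ _ gamma_mul_add_mul_gamma minkowski_isSymm (so_skew X) A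

theorem spin_soBracket (X Y : so K) : spin K (soBracket K X Y) = ⁅spin K X, spin K Y⁆ :=
  (lie_spinRep_spinRep _ _ gamma_mul_add_mul_gamma minkowski_isSymm (so_skew X) Y.1).symm

theorem pairing_spin (X : so K) (Ψ Φ : Spinor K) :
    pairing K (spin K X Ψ) Φ = -pairing K Ψ (spin K X Φ) := by
  rw [spin_eq_spinRep, spinRep_skew _ _ pairing_gamma_left minkowski_isSymm (so_skew X)]

end CliffordAction

/-! ## The bracket of spinors -/

section Dot

variable {K : Type} [NormedDivisionAlgebra K]

theorem dot_comm (Ψ Φ : Spinor K) : dot K Ψ Φ = dot K Φ Ψ :=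
  ext_minkowski fun A => by rw [minkowski_dot, minkowski_dot, pairing_gamma_comm]

theorem so_dot (X : so K) (Ψ Φ : Spinor K) :
    X.1 (dot K Ψ Φ) = dot K (spin K X Ψ) Φ + dot K Ψ (spin K X Φ) :=
  ext_minkowski fun A => by
    rw [so_skew, minkowski_dot, ← lie_spin_gamma, Ring.lie_def, map_add, LinearMap.add_apply,
      minkowski_dot, minkowski_dot, pairing_spin, LinearMap.sub_apply, map_sub,
      Module.End.mul_apply, Module.End.mul_apply]
    ring

theorem dot_self (Ψ : Spinor K) : dot K Ψ Ψ =
    vec (2 * (innerForm (Ψ (.inl 0)) (Ψ (.inr 0)) + innerForm (Ψ (.inl 1)) (Ψ (.inr 1))))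
      (2 * (innerForm (Ψ (.inl 1)) (Ψ (.inl 1)) + innerForm (Ψ (.inr 0)) (Ψ (.inr 0))))
      (2 * (innerForm (Ψ (.inl 0)) (Ψ (.inl 0)) + innerForm (Ψ (.inr 1)) (Ψ (.inr 1))))
      ((2 : ℝ) • (Ψ (.inr 0) * star (Ψ (.inr 1)) - Ψ (.inl 0) * star (Ψ (.inl 1)))) :=
  ext_minkowski fun A => by
    obtain ⟨a, p, s, z, rfl⟩ := exists_eq_vec A
    rw [minkowski_dot, minkowski_vec, pairing_eq, gamma_vec]
    generalize Ψ (.inl 0) = x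
    generalize Ψ (.inl 1) = y
    generalize Ψ (.inr 0) = u
    generalize Ψ (.inr 1) = w
    have star_mul_right : ∀ b c : K, innerForm c (star z * b) = innerForm b (z * c) :=
      fun b c => by rw [innerForm_comm b, innerForm_mul_left]
    have mul_star_left : ∀ b c : K, innerForm (b * star c) z = innerForm b (z * c) :=
      fun b c => by rw [innerForm_mul_right, star_star]
    simp only [Sum.elim_inl, Sum.elim_inr, Matrix.cons_val_zero, Matrix.cons_val_one, map_add,
      map_sub, map_smul, smul_eq_mul, star_mul_right, mul_star_left, innerForm_comm u x,
      innerForm_comm w y, LinearMap.sub_apply, LinearMap.smul_apply]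
    ring

theorem pairing_gamma_dot_self (Ψ : Spinor K) (A : Vec K) :
    pairing K (gamma K (dot K Ψ Ψ) Ψ) (gamma K A Ψ) = 0 := by
  obtain ⟨a, p, s, z, rfl⟩ := exists_eq_vec A
  rw [dot_self, pairing_eq, gamma_vec, gamma_vec]
  generalize Ψ (.inl 0) = x
  generalize Ψ (.inl 1) = y
  generalize Ψ (.inr 0) = u
  generalize Ψ (.inr 1) = w
  -- The four products of all of `x, y, u, w` that occur have the same real part.
  have e1 : innerForm (u * star w * y) x = innerForm (x * star y * w) u := by
    rw [innerForm_mul_right, innerForm_comm, innerForm_mul_right (x * star y)]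
  have e2 : innerForm (w * star u * x) y = innerForm (x * star y * w) u := by
    rw [← e1, innerForm_mul_left, star_mul, star_star, innerForm_comm]
  have e3 : innerForm (y * star x * u) w = innerForm (x * star y * w) u := by
    rw [innerForm_mul_left, star_mul, star_star, innerForm_comm]
  have star_mul_right : ∀ b c : K, innerForm b (star z * c) = innerForm c (z * b) :=
    fun b c => by rw [innerForm_comm c, innerForm_mul_left]
  simp only [Sum.elim_inl, Sum.elim_inr, Matrix.cons_val_zero, Matrix.cons_val_one, star_sub,
    star_smul', star_mul, star_star, sub_mul, smul_mul_assoc, mul_star_mul_cancel_right, map_add,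
    map_sub, map_smul, smul_eq_mul, LinearMap.add_apply, LinearMap.sub_apply,
    LinearMap.smul_apply, smul_sub, innerForm_mul_star_mul_mul, innerForm_mul_star_mul_self,
    e1, e2, e3, innerForm_comm u x, innerForm_comm w y]
  simp only [star_mul_right]
  ring

end Dot

/-! ## The four-spinor identity -/

section Polarization

variable {k V W : Type*} [Field k] [CharZero k] [AddCommGroup V] [Module k V] [AddCommGroup W]
  [Module k W] {F : V →ₗ[k] V →ₗ[k] V →ₗ[k] V →ₗ[k] W}

theorem biquadratic_of_apply_self (hl : ∀ x y z w, F x y z w = F y x z w)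
    (hr : ∀ x y z w, F x y z w = F x y w z) (h : ∀ x, F x x x x = 0) (x y : V) :
    F x x y y + F y y x x + (4 : k) • F x y x y = 0 := by
  have hadd := h (x + y)
  have hsub := h (x - y)
  simp only [map_add, map_sub, LinearMap.add_apply, LinearMap.sub_apply, h, hl y x, hr _ _ y x]
    at hadd hsub
  linear_combination (norm := module) (1 / 2 : k) • hadd + (1 / 2 : k) • hsub

theorem sum_pairings_eq_zero_of_apply_self (hl : ∀ x y z w, F x y z w = F y x z w)
    (hr : ∀ x y z w, F x y z w = F x y w z) (h : ∀ x, F x x x x = 0) (x y z w : V) :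
    F x y z w + F x z y w + F x w y z + F y z x w + F y w x z + F z w x y = 0 := by
  have hq := biquadratic_of_apply_self hl hr h
  have hxyzw := hq (x + y) (z + w)
  have hxzw := hq x (z + w)
  have hyzw := hq y (z + w)
  have hxyz := hq (x + y) z
  have hxyw := hq (x + y) w
  simp only [map_add, LinearMap.add_apply, hl y x, hl w z, hr _ _ y x, hr _ _ w z]
    at hxyzw hxzw hyzw hxyz hxyw
  linear_combination (norm := module) (1 / 4 : k) • (hxyzw - hxzw - hyzw - hxyz - hxyw +
    hq x z + hq x w + hq y z + hq y w)

end Polarization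

section CliffordForm

variable {K : Type} [NormedDivisionAlgebra K]

/-- The quadrilinear form `⟨Ψ, (Γ(𝒜) Γ(𝒞) - Γ(𝒞) Γ(𝒜)) Φ⟩` in the arguments `𝒜, 𝒞, Ψ, Φ`, of which
`β` is the extension to arguments in any order. -/
noncomputable def cliffordForm : Vec K →ₗ[ℝ] Vec K →ₗ[ℝ] Spinor K →ₗ[ℝ] Spinor K →ₗ[ℝ] ℝ :=
  LinearMap.mk₂ ℝ
    (fun A C => (pairing K).compl₂ (gamma K A * gamma K C - gamma K C * gamma K A))
    (fun A A' C => LinearMap.ext₂ fun Ψ Φ => by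
      simp only [LinearMap.compl₂_apply, LinearMap.sub_apply, LinearMap.add_apply,
        Module.End.mul_apply, map_add, map_sub]
      ring)
    (fun r A C => LinearMap.ext₂ fun Ψ Φ => by
      simp only [LinearMap.compl₂_apply, LinearMap.sub_apply, LinearMap.smul_apply,
        Module.End.mul_apply, map_smul, map_sub, smul_sub])
    (fun A C C' => LinearMap.ext₂ fun Ψ Φ => by
      simp only [LinearMap.compl₂_apply, LinearMap.sub_apply, LinearMap.add_apply,
        Module.End.mul_apply, map_add, map_sub]
      ring)
    (fun r A C => LinearMap.ext₂ fun Ψ Φ => by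
      simp only [LinearMap.compl₂_apply, LinearMap.sub_apply, LinearMap.smul_apply,
        Module.End.mul_apply, map_smul, map_sub, smul_sub])

theorem cliffordForm_apply (A C : Vec K) (Ψ Φ : Spinor K) : cliffordForm A C Ψ Φ =
    pairing K Ψ (gamma K A (gamma K C Φ)) - pairing K Ψ (gamma K C (gamma K A Φ)) :=
  map_sub (pairing K Ψ) _ _

theorem cliffordForm_comm (A C : Vec K) (Ψ Φ : Spinor K) :
    cliffordForm A C Ψ Φ = cliffordForm A C Φ Ψ := by
  have h : ∀ A C : Vec K, pairing K Ψ (gamma K A (gamma K C Φ)) =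
      -pairing K Φ (gamma K C (gamma K A Ψ)) := fun A C => by
    rw [← neg_neg (pairing K Ψ _), ← pairing_gamma_left, pairing_gamma_comm]
  rw [cliffordForm_apply, cliffordForm_apply, h, h]
  ring

theorem cliffordForm_skew (A C : Vec K) (Ψ Φ : Spinor K) :
    cliffordForm A C Ψ Φ = -cliffordForm C A Ψ Φ := by
  rw [cliffordForm_apply, cliffordForm_apply]
  ring

theorem cliffordForm_invariant (X : so K) (A C : Vec K) (Ψ Φ : Spinor K) :
    cliffordForm (X.1 A) C Ψ Φ + cliffordForm A (X.1 C) Ψ Φ + cliffordForm A C (spin K X Ψ) Φ +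
      cliffordForm A C Ψ (spin K X Φ) = 0 := by
  simp only [cliffordForm_apply, ← lie_spin_gamma, Ring.lie_def, pairing_spin,
    LinearMap.sub_apply, Module.End.mul_apply, map_sub]
  ring

theorem cliffordForm_dot_self (Ψ : Spinor K) (A : Vec K) :
    cliffordForm (dot K Ψ Ψ) A Ψ Ψ = 0 := by
  have h := pairing_gamma_dot_self Ψ A
  have h' := pairing_skew (gamma K A Ψ) (gamma K (dot K Ψ Ψ) Ψ)
  rw [pairing_gamma_left] at h h'
  rw [pairing_gamma_left] at h'
  rw [cliffordForm_apply]
  linarith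

theorem sum_cliffordForm_dot (A : Vec K) (Ψ₁ Ψ₂ Ψ₃ Ψ₄ : Spinor K) :
    cliffordForm (dot K Ψ₁ Ψ₂) A Ψ₃ Ψ₄ + cliffordForm (dot K Ψ₁ Ψ₃) A Ψ₂ Ψ₄ +
      cliffordForm (dot K Ψ₁ Ψ₄) A Ψ₂ Ψ₃ + cliffordForm (dot K Ψ₂ Ψ₃) A Ψ₁ Ψ₄ +
      cliffordForm (dot K Ψ₂ Ψ₄) A Ψ₁ Ψ₃ + cliffordForm (dot K Ψ₃ Ψ₄) A Ψ₁ Ψ₂ = 0 :=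
  sum_pairings_eq_zero_of_apply_self (F := (dot K).compr₂ (cliffordForm.flip A))
    (fun Ψ Φ Ξ Ω => by simp only [LinearMap.compr₂_apply, dot_comm Φ Ψ])
    (fun Ψ Φ Ξ Ω => cliffordForm_comm (dot K Ψ Φ) A Ξ Ω)
    (fun Ψ => cliffordForm_dot_self Ψ A) Ψ₁ Ψ₂ Ψ₃ Ψ₄

end CliffordForm

/-! ## Koszul signs -/

section Koszul

theorem sgn_zero : sgn 0 = 1 := if_pos rfl

theorem sgn_one : sgn 1 = -1 := if_neg one_ne_zero

theorem sgn_mul_self (a : ZMod 2) : sgn a * sgn a = 1 := by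
  unfold sgn
  split_ifs <;> norm_num

/-- The Koszul sign of the pair of positions `i`, `j` in a word with letters of parities `q`: the
letter `i` precedes the letter `j` after the reordering, so that a sign arises if `j < i`. The
values on `i < j` and on the diagonal are such that `exchangeSign` is antisymmetric up to the sign
`sgn (q i * q j)`, which makes products over pairs reindexable. -/
noncomputable def exchangeSign {n : ℕ} (q : Fin n → ZMod 2) (i j : Fin n) : ℝ :=
  if i < j then 1 else if j < i then -sgn (q i * q j) else 0

variable {n : ℕ}

theorem exchangeSign_of_lt (q : Fin n → ZMod 2) {i j : Fin n} (h : i < j) :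
    exchangeSign q i j = 1 :=
  if_pos h

theorem exchangeSign_of_gt (q : Fin n → ZMod 2) {i j : Fin n} (h : j < i) :
    exchangeSign q i j = -sgn (q i * q j) := by
  rw [exchangeSign, if_neg h.not_gt, if_pos h]

theorem exchangeSign_self (q : Fin n → ZMod 2) (i : Fin n) : exchangeSign q i i = 0 := by
  simp [exchangeSign]

theorem exchangeSign_swap (q : Fin n → ZMod 2) (i j : Fin n) :
    exchangeSign q i j = -sgn (q i * q j) * exchangeSign q j i := by
  rcases lt_trichotomy i j with h | rfl | h
  · rw [exchangeSign_of_lt q h, exchangeSign_of_gt q h, mul_comm (q j), neg_mul_neg, sgn_mul_self]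
  · rw [exchangeSign_self, mul_zero]
  · rw [exchangeSign_of_lt q h, exchangeSign_of_gt q h, mul_one]

theorem exchangeSign_mul_self (q : Fin n → ZMod 2) {i j : Fin n} (h : i ≠ j) :
    exchangeSign q i j * exchangeSign q i j = 1 := by
  rcases h.lt_or_gt with h | h
  · rw [exchangeSign_of_lt q h, one_mul]
  · rw [exchangeSign_of_gt q h, neg_mul_neg, sgn_mul_self]

theorem prod_Iio_exchangeSign (q : Fin n → ZMod 2) :
    ∏ j, ∏ i ∈ Finset.Iio j, exchangeSign q i j = 1 :=
  Finset.prod_eq_one fun _ _ => Finset.prod_eq_one fun _ hi =>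
    exchangeSign_of_lt q (Finset.mem_Iio.mp hi)

theorem chi_eq_prod_exchangeSign (σ : Equiv.Perm (Fin n)) (q : Fin n → ZMod 2) :
    chi σ q = ∏ j, ∏ i ∈ Finset.Iio j, exchangeSign q (σ i) (σ j) := by
  rw [chi, σ.sign_eq_prod_prod_Iio, Finset.prod_comm]
  push_cast
  rw [← Finset.prod_mul_distrib]
  refine Finset.prod_congr rfl fun j _ => ?_
  have hIio : Finset.Iio j = Finset.univ.filter (· < j) := by ext; simp
  rw [hIio, Finset.prod_filter, Finset.prod_filter, ← Finset.prod_mul_distrib]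
  refine Finset.prod_congr rfl fun i _ => ?_
  by_cases hij : i < j
  · rcases (σ.injective.ne hij.ne).lt_or_gt with h | h
    · simp [hij, h, h.not_gt, exchangeSign_of_lt q h]
    · simp [hij, h, h.not_gt, exchangeSign_of_gt q h]
  · simp [hij]

/-- Multiplying `f` by the antisymmetric `exchangeSign 0` reduces this to the reindexing of
antisymmetric functions, at the cost of a factor `sign τ` on both sides. -/
theorem prod_Iio_comp_of_symm (τ : Equiv.Perm (Fin n)) {f : Fin n → Fin n → ℝ}
    (hf : ∀ i j, f i j = f j i) :
    ∏ j, ∏ i ∈ Finset.Iio j, f (τ i) (τ j) = ∏ j, ∏ i ∈ Finset.Iio j, f i j := by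
  have hswap : ∀ i j : Fin n, exchangeSign 0 i j = -exchangeSign 0 j i := fun i j => by
    rw [exchangeSign_swap, Pi.zero_apply, zero_mul, sgn_zero, neg_one_mul]
  have hsign := τ.prod_Iio_comp_eq_sign_mul_prod hswap
  have hmul := τ.prod_Iio_comp_eq_sign_mul_prod (f := fun i j => exchangeSign 0 i j * f i j)
    fun i j => by rw [hswap, hf i j, neg_mul]
  simp only [Finset.prod_mul_distrib] at hmul
  rw [hsign, prod_Iio_exchangeSign, mul_one, one_mul] at hmul
  exact mul_left_cancel₀ (mod_cast (Equiv.Perm.sign τ).ne_zero) hmul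

theorem chi_mul_self (σ : Equiv.Perm (Fin n)) (q : Fin n → ZMod 2) : chi σ q * chi σ q = 1 := by
  simp only [chi_eq_prod_exchangeSign, ← Finset.prod_mul_distrib]
  exact Finset.prod_eq_one fun j _ => Finset.prod_eq_one fun i hi =>
    exchangeSign_mul_self q (σ.injective.ne (Finset.mem_Iio.mp hi).ne)

theorem chi_mul (σ τ : Equiv.Perm (Fin n)) (q : Fin n → ZMod 2) :
    chi (σ * τ) q = chi σ q * chi τ (q ∘ σ) := by
  have h : chi (σ * τ) q * chi τ (q ∘ σ) = chi σ q := by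
    have hprod := prod_Iio_comp_of_symm τ
      (f := fun i j => exchangeSign q (σ i) (σ j) * exchangeSign (q ∘ σ) i j) fun i j => by
        rw [exchangeSign_swap q, exchangeSign_swap _ i j, Function.comp_apply, Function.comp_apply]
        linear_combination (exchangeSign q (σ j) (σ i) * exchangeSign (q ∘ σ) j i) *
          sgn_mul_self (q (σ i) * q (σ j))
    simpa only [Finset.prod_mul_distrib, prod_Iio_exchangeSign, mul_one,
      ← Equiv.Perm.mul_apply, ← chi_eq_prod_exchangeSign] using hprod
  rw [← h, mul_assoc, chi_mul_self, mul_one]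

theorem chi_one (q : Fin n → ZMod 2) : chi 1 q = 1 := by
  rw [chi_eq_prod_exchangeSign]
  exact prod_Iio_exchangeSign q

theorem chi_swap_adjacent (i : Fin n) (q : Fin (n + 1) → ZMod 2) :
    chi (Equiv.swap i.castSucc i.succ) q = -sgn (q i.castSucc * q i.succ) := by
  have hlt : i.castSucc < i.succ := Fin.castSucc_lt_succ
  have hinv : ∀ a b : Fin (n + 1), a < b →
      Equiv.swap i.castSucc i.succ b < Equiv.swap i.castSucc i.succ a →
      a = i.castSucc ∧ b = i.succ := by
    intro a b h₁ h₂
    simp only [Equiv.swap_apply_def] at h₂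
    split_ifs at h₂ <;> simp only [Fin.ext_iff, Fin.lt_def, Fin.val_castSucc, Fin.val_succ] at * <;>
      omega
  rw [chi, Equiv.Perm.sign_swap hlt.ne, Finset.prod_eq_single i.castSucc,
    Finset.prod_eq_single i.succ]
  · simp [hlt, mul_comm]
  · exact fun b _ hb => if_neg fun h => hb (hinv _ _ h.1 h.2).2
  · simp
  · exact fun a _ ha => Finset.prod_eq_one fun b _ => if_neg fun h => ha (hinv _ _ h.1 h.2).1
  · simp

theorem chi_cycleRange_symm (j : Fin (n + 1)) (q : Fin (n + 1) → ZMod 2) :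
    chi j.cycleRange.symm q = (-1) ^ (j : ℕ) * ∏ a ∈ Finset.Iio j, sgn (q j * q a) := by
  have hIio : Finset.Iio j = Finset.univ.filter (· < j) := by ext; simp
  have hasymm : ∀ a b : Fin n, ¬(a < b ∧ b < a) := fun _ _ h => lt_asymm h.1 h.2
  rw [chi, Equiv.Perm.sign_symm, Fin.sign_cycleRange, hIio, Finset.prod_filter,
    Fin.prod_univ_succAbove (fun a => if a < j then sgn (q j * q a) else 1) j]
  simp [Fin.prod_univ_succ, hasymm]

theorem chi_decomposeFin_symm_zero (τ : Equiv.Perm (Fin n)) (q : Fin (n + 1) → ZMod 2) :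
    chi (Equiv.Perm.decomposeFin.symm (0, τ)) q = chi τ (q ∘ Fin.succ) := by
  simp [chi, Equiv.Perm.decomposeFin.symm_sign, Fin.prod_univ_succ]

variable {g R : Type*} [AddCommGroup g] [Module ℝ g] [AddCommGroup R] [Module ℝ R]

theorem skew_of_adjacent (G : ZMod 2 → Submodule ℝ g) {ω : (Fin (n + 1) → g) → R}
    (h : ∀ (i : Fin n) (q : Fin (n + 1) → ZMod 2) (x : Fin (n + 1) → g), (∀ a, x a ∈ G (q a)) →
      ω (fun a => x (Equiv.swap i.castSucc i.succ a)) =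
        -(sgn (q i.castSucc * q i.succ) • ω x))
    (q : Fin (n + 1) → ZMod 2) (x : Fin (n + 1) → g) (hx : ∀ a, x a ∈ G (q a))
    (σ : Equiv.Perm (Fin (n + 1))) : ω (fun a => x (σ a)) = chi σ q • ω x := by
  have hσ : σ ∈ Submonoid.closure
      (Set.range fun i : Fin n => Equiv.swap i.castSucc i.succ) := by
    rw [Equiv.Perm.mclosure_swap_castSucc_succ]
    trivial
  induction hσ using Submonoid.closure_induction generalizing q x with
  | mem σ hσ =>
    obtain ⟨i, rfl⟩ := hσ
    rw [h i q x hx, chi_swap_adjacent, neg_smul]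
  | one => rw [chi_one, one_smul]; rfl
  | mul σ τ _ _ ihσ ihτ =>
    have hστ := ihτ (q ∘ σ) (fun a => x (σ a)) fun a => hx (σ a)
    rw [ihσ q x hx, smul_smul, mul_comm, ← chi_mul] at hστ
    exact hστ

end Koszul

/-! ## Unshuffles moving two arguments to the front -/

section PairFirst

variable {n : ℕ}

/-- The permutation of positions that moves the pair `j.succAbove i`, `j` to the front, in this
order, and keeps the order of the other positions. -/
noncomputable def pairFirst (i : Fin (n + 1)) (j : Fin (n + 2)) : Equiv.Perm (Fin (n + 2)) :=
  j.cycleRange.symm * Equiv.Perm.decomposeFin.symm (0, i.cycleRange.symm) * Equiv.swap 0 1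

theorem pairFirst_zero (i : Fin (n + 1)) (j : Fin (n + 2)) :
    pairFirst i j 0 = j.succAbove i := by
  simp [pairFirst]

theorem pairFirst_one (i : Fin (n + 1)) (j : Fin (n + 2)) : pairFirst i j 1 = j := by
  simp [pairFirst]

theorem pairFirst_succ_succ (i : Fin (n + 1)) (j : Fin (n + 2)) (k : Fin n) :
    pairFirst i j k.succ.succ = j.succAbove (i.succAbove k) := by
  have hswap : Equiv.swap (0 : Fin (n + 2)) 1 k.succ.succ = k.succ.succ :=
    Equiv.swap_apply_of_ne_of_ne (Fin.succ_ne_zero _) (by simp [Fin.ext_iff])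
  simp [pairFirst, hswap]

theorem chi_pairFirst {i : Fin (n + 1)} {j : Fin (n + 2)} (h : i.castSucc < j)
    (q : Fin (n + 2) → ZMod 2) :
    chi (pairFirst i j) q = -((-1) ^ ((i : ℕ) + (j : ℕ)) * sgn (q i.castSucc * q j) *
      (∏ a ∈ Finset.Iio i.castSucc, sgn (q i.castSucc * q a)) *
      ∏ a ∈ Finset.Iio j, sgn (q j * q a)) := by
  have hi : j.succAbove i = i.castSucc := Fin.succAbove_of_castSucc_lt j i h
  have hprod : ∏ a ∈ Finset.Iio i, sgn (q i.castSucc * q (j.succAbove a)) =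
      ∏ a ∈ Finset.Iio i, sgn (q i.castSucc * q a.castSucc) :=
    Finset.prod_congr rfl fun a ha => by
      rw [Fin.succAbove_of_castSucc_lt j a
        ((Fin.castSucc_lt_castSucc_iff.mpr (Finset.mem_Iio.mp ha)).trans h)]
  have hswap := chi_swap_adjacent (0 : Fin (n + 1))
    (q ∘ ⇑(j.cycleRange.symm * Equiv.Perm.decomposeFin.symm (0, i.cycleRange.symm)))
  rw [Fin.castSucc_zero, Fin.succ_zero_eq_one] at hswap
  rw [pairFirst, chi_mul, hswap, chi_mul, chi_cycleRange_symm, chi_decomposeFin_symm_zero,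
    chi_cycleRange_symm, Fin.prod_Iio_castSucc]
  simp only [Function.comp_apply, Equiv.Perm.mul_apply, Fin.cycleRange_symm_succ,
    Equiv.Perm.decomposeFin_symm_apply_zero, Equiv.Perm.decomposeFin_symm_apply_one,
    Fin.cycleRange_symm_zero, Equiv.swap_self, Equiv.refl_apply, hi, pow_add,
    mul_comm (q j) (q i.castSucc), hprod]
  ring

/-- The condition that a permutation of `n + 2` positions is a `(2, n)`-unshuffle. -/
def IsPairUnshuffle (σ : Equiv.Perm (Fin (n + 2))) : Prop :=
  σ 0 < σ 1 ∧ StrictMono fun k : Fin n => σ k.succ.succ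

theorem isPairUnshuffle_pairFirst {i : Fin (n + 1)} {j : Fin (n + 2)} (h : i.castSucc < j) :
    IsPairUnshuffle (pairFirst i j) := by
  refine ⟨?_, fun a b hab => ?_⟩
  · rwa [pairFirst_zero, pairFirst_one, Fin.succAbove_of_castSucc_lt j i h]
  · simp only [pairFirst_succ_succ]
    exact Fin.strictMono_succAbove j (Fin.strictMono_succAbove i hab)

theorem IsPairUnshuffle.ext {σ τ : Equiv.Perm (Fin (n + 2))} (hσ : IsPairUnshuffle σ)
    (hτ : IsPairUnshuffle τ) (h₀ : σ 0 = τ 0) (h₁ : σ 1 = τ 1) : σ = τ := by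
  have hrange : ∀ ρ : Equiv.Perm (Fin (n + 2)),
      Set.range (fun k : Fin n => ρ k.succ.succ) = {ρ 0, ρ 1}ᶜ := fun ρ => by
    have hsucc : Set.range (fun k : Fin n => k.succ.succ) = {0, 1}ᶜ := by
      ext k
      refine Fin.cases ?_ (fun k => Fin.cases ?_ (fun k => ?_) k) k <;> simp [Fin.ext_iff]
    rw [← Set.image_pair, ← Set.image_compl_eq ρ.bijective, ← hsucc, ← Set.range_comp]
    rfl
  have hrest := (hσ.2.range_inj hτ.2).mp (by rw [hrange, hrange, h₀, h₁])
  refine Equiv.ext fun k => Fin.cases h₀ (fun k => Fin.cases h₁ (fun k => ?_) k) k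
  exact congrFun hrest k

theorem IsPairUnshuffle.exists_eq_pairFirst {σ : Equiv.Perm (Fin (n + 2))}
    (hσ : IsPairUnshuffle σ) : ∃ i j, i.castSucc < j ∧ pairFirst i j = σ := by
  obtain ⟨i, hi⟩ : ∃ i : Fin (n + 1), i.castSucc = σ 0 :=
    Fin.exists_castSucc_eq.mpr (hσ.1.trans_le (Fin.le_last _)).ne
  have hlt : i.castSucc < σ 1 := hi ▸ hσ.1
  refine ⟨i, σ 1, hlt, (isPairUnshuffle_pairFirst hlt).ext hσ ?_ (pairFirst_one i _)⟩
  rw [pairFirst_zero, Fin.succAbove_of_castSucc_lt _ i hlt, hi]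

theorem pairFirst_inj {i i' : Fin (n + 1)} {j j' : Fin (n + 2)}
    (h : pairFirst i j = pairFirst i' j') : i = i' ∧ j = j' := by
  have hj : j = j' := by rw [← pairFirst_one i j, h, pairFirst_one]
  subst hj
  refine ⟨Fin.succAbove_right_injective (p := j) ?_, rfl⟩
  rw [← pairFirst_zero, h, pairFirst_zero]

open Classical in
theorem sum_isPairUnshuffle {M : Type*} [AddCommMonoid M] (F : Equiv.Perm (Fin (n + 2)) → M) :
    ∑ σ, (if IsPairUnshuffle σ then F σ else 0) =
      ∑ j : Fin (n + 2), ∑ i : Fin (n + 1), if i.castSucc < j then F (pairFirst i j) else 0 := by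
  rw [← Fintype.sum_prod_type', ← Finset.sum_filter, ← Finset.sum_filter]
  symm
  refine Finset.sum_bij (fun p _ => pairFirst p.2 p.1) (fun p hp => ?_) (fun p _ p' _ h => ?_)
    (fun σ hσ => ?_) fun _ _ => rfl
  · exact Finset.mem_filter.mpr ⟨Finset.mem_univ _,
      isPairUnshuffle_pairFirst (Finset.mem_filter.mp hp).2⟩
  · exact Prod.ext (pairFirst_inj h).2 (pairFirst_inj h).1
  · obtain ⟨i, j, hij, rfl⟩ := (Finset.mem_filter.mp hσ).2.exists_eq_pairFirst
    exact ⟨(j, i), Finset.mem_filter.mpr ⟨Finset.mem_univ _, hij⟩, rfl⟩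

theorem isUnshuffle_two_iff (σ : Equiv.Perm (Fin (n + 2))) :
    LInftyData.IsUnshuffle ((finCongr (add_comm n 2)).permCongr σ) ↔ IsPairUnshuffle σ := by
  have hrest : ∀ k : Fin n, (finCongr (add_comm n 2)).symm (Fin.natAdd 2 k) = k.succ.succ :=
    fun k => Fin.ext (add_comm 2 _)
  simp only [LInftyData.IsUnshuffle, IsPairUnshuffle, Equiv.permCongr_apply, hrest]
  rw [Fin.strictMono_iff_lt_succ, Fin.forall_fin_one]
  rfl

open Classical in
theorem sum_isUnshuffle_two {M : Type*} [AddCommMonoid M] (F : Equiv.Perm (Fin (2 + n)) → M) :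
    ∑ σ, (if LInftyData.IsUnshuffle σ then F σ else 0) =
      ∑ j : Fin (n + 2), ∑ i : Fin (n + 1), if i.castSucc < j then
        F ((finCongr (add_comm n 2)).permCongr (pairFirst i j)) else 0 := by
  rw [← Equiv.sum_comp (finCongr (add_comm n 2)).permCongr]
  simp only [isUnshuffle_two_iff]
  exact sum_isPairUnshuffle _

theorem chi_permCongr_finCongr {m : ℕ} (h : n = m) (σ : Equiv.Perm (Fin n)) (q : Fin n → ZMod 2) :
    chi ((finCongr h).permCongr σ) (q ∘ (finCongr h).symm) = chi σ q := by
  subst h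
  rfl

end PairFirst

/-! ## The generalized Jacobi identity and the coboundary -/

section Jacobi

variable {L : Type} [AddCommGroup L] [Module ℝ L]

theorem coboundary_eq_neg_sum_chi {g R : Type} [AddCommGroup g] [Module ℝ g] [AddCommGroup R]
    [Module ℝ R] (br : g → g → g) (p : ZMod 2) {n : ℕ}
    (ω : MultilinearMap ℝ (fun _ : Fin (n + 1) => g) R) (q : Fin (n + 2) → ZMod 2)
    (X : Fin (n + 2) → g) :
    coboundary br (fun _ _ => 0) p ω q X = -∑ j : Fin (n + 2), ∑ i : Fin (n + 1),
      if i.castSucc < j then chi (pairFirst i j) q •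
        ω (Fin.cons (br (X i.castSucc) (X j)) fun k => X (j.succAbove (i.succAbove k))) else 0 := by
  simp only [coboundary, smul_zero, Finset.sum_const_zero, zero_add, ← Finset.sum_neg_distrib]
  refine Finset.sum_congr rfl fun j _ => Finset.sum_congr rfl fun i _ => ?_
  split_ifs with h
  · rw [chi_pairFirst h, neg_smul, neg_neg]
  · rw [neg_zero]

theorem jacobiTerm_two (A : LInftyData L) {n : ℕ} (d : Fin (n + 2) → ℤ × ZMod 2)
    (x : Fin (n + 2) → L) :
    A.jacobiTerm 2 n (d ∘ Fin.cast (add_comm 2 n)) (x ∘ Fin.cast (add_comm 2 n)) =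
      -coboundary (fun y z => A.l 2 ![y, z]) (fun _ _ => 0) 0 (A.l (n + 1))
        (fun a => LInftyData.grade (d a)) x := by
  rw [coboundary_eq_neg_sum_chi, neg_neg, LInftyData.jacobiTerm, sum_isUnshuffle_two]
  refine Finset.sum_congr rfl fun j _ => Finset.sum_congr rfl fun i _ => if_ctx_congr Iff.rfl
    (fun h => ?_) fun _ => rfl
  have hpair : (fun a : Fin 2 => (x ∘ Fin.cast (add_comm 2 n))
      ((finCongr (add_comm n 2)).permCongr (pairFirst i j) (Fin.castAdd n a))) =
      ![x i.castSucc, x j] := by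
    funext a
    fin_cases a
    · exact congrArg x ((pairFirst_zero i j).trans (Fin.succAbove_of_castSucc_lt j i h))
    · exact congrArg x (pairFirst_one i j)
  have hrest : (fun b : Fin n => (x ∘ Fin.cast (add_comm 2 n))
      ((finCongr (add_comm n 2)).permCongr (pairFirst i j) (Fin.natAdd 2 b))) =
      fun k => x (j.succAbove (i.succAbove k)) := by
    funext k
    have hk : (finCongr (add_comm n 2)).symm (Fin.natAdd 2 k) = k.succ.succ :=
      Fin.ext (add_comm 2 _)
    rw [Equiv.permCongr_apply, hk, pairFirst_succ_succ]
    rfl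
  rw [hpair, hrest, (even_two_mul n).neg_one_pow, mul_one]
  have hchi := chi_permCongr_finCongr (add_comm n 2) (pairFirst i j)
    fun a => LInftyData.grade (d a)
  rw [← hchi]
  rfl

end Jacobi

/-! ## Coboundaries -/

theorem zmod_two_eq_zero_or_one (a : ZMod 2) : a = 0 ∨ a = 1 := by
  revert a
  decide

theorem sgn_add (a b : ZMod 2) : sgn (a + b) = sgn a * sgn b := by
  have htwo : (1 + 1 : ZMod 2) = 0 := by decide
  rcases zmod_two_eq_zero_or_one a with rfl | rfl <;>
    rcases zmod_two_eq_zero_or_one b with rfl | rfl <;> simp [sgn_zero, sgn_one, htwo]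

theorem sgn_mul_prod_Iio {n : ℕ} (q : Fin n → ZMod 2) {i j : Fin n} (h : i < j) :
    sgn (q i * q j) * ∏ a ∈ Finset.Iio j, sgn (q j * q a) =
      ∏ a, if a < j ∧ a ≠ i then sgn (q j * q a) else 1 := by
  have herase : Finset.univ.filter (fun a => a < j ∧ a ≠ i) = (Finset.Iio j).erase i := by
    ext
    simp [and_comm]
  rw [← Finset.prod_filter, herase, ← Finset.mul_prod_erase _ _ (Finset.mem_Iio.mpr h),
    mul_comm (q i), ← mul_assoc, sgn_mul_self, one_mul]

section Coboundary

variable {g g' R R' : Type} [AddCommGroup g] [Module ℝ g] [AddCommGroup g'] [Module ℝ g']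
  [AddCommGroup R] [Module ℝ R] [AddCommGroup R'] [Module ℝ R']

theorem coboundary_eq_sum_ite (br : g → g → g) (p : ZMod 2) {n : ℕ}
    (ω : MultilinearMap ℝ (fun _ : Fin (n + 1) => g) R) (q : Fin (n + 2) → ZMod 2)
    (X : Fin (n + 2) → g) :
    coboundary br (fun _ _ => 0) p ω q X = ∑ j : Fin (n + 2), ∑ i : Fin (n + 1),
      if i.castSucc < j then ((-1 : ℝ) ^ ((i : ℕ) + (j : ℕ)) *
          (∏ a, if a < i.castSucc then sgn (q i.castSucc * q a) else 1) *
          ∏ a, if a < j ∧ a ≠ i.castSucc then sgn (q j * q a) else 1) •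
        ω (Fin.cons (br (X i.castSucc) (X j)) fun k => X (j.succAbove (i.succAbove k)))
      else 0 := by
  simp only [coboundary, smul_zero, Finset.sum_const_zero, zero_add]
  refine Finset.sum_congr rfl fun j _ => Finset.sum_congr rfl fun i _ => ?_
  split_ifs with h
  · rw [← sgn_mul_prod_Iio q h, ← Finset.prod_filter, Finset.filter_gt_eq_Iio]
    ring_nf
  · rfl

theorem coboundary_two (br : g → g → g) (p : ZMod 2)
    (ω : MultilinearMap ℝ (fun _ : Fin 2 => g) R) (q : Fin 3 → ZMod 2) (X : Fin 3 → g) :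
    coboundary br (fun _ _ => 0) p ω q X =
      -ω ![br (X 0) (X 1), X 2] + sgn (q 2 * q 1) • ω ![br (X 0) (X 2), X 1] -
        (sgn (q 1 * q 0) * sgn (q 2 * q 0)) • ω ![br (X 1) (X 2), X 0] := by
  have hcons : ∀ (b : g) (f : Fin 1 → g), (Fin.cons b f : Fin 2 → g) = ![b, f 0] :=
    fun b f => by
      rw [← FinVec.etaExpand_eq f]
      rfl
  rw [coboundary_eq_sum_ite]
  simp [Fin.sum_univ_succ, Fin.prod_univ_succ, Fin.succAbove, hcons]
  module

theorem coboundary_four (br : g → g → g) (p : ZMod 2)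
    (ω : MultilinearMap ℝ (fun _ : Fin 4 => g) R) (q : Fin 5 → ZMod 2) (X : Fin 5 → g) :
    coboundary br (fun _ _ => 0) p ω q X =
      -ω ![br (X 0) (X 1), X 2, X 3, X 4] +
      sgn (q 2 * q 1) • ω ![br (X 0) (X 2), X 1, X 3, X 4] -
      (sgn (q 3 * q 1) * sgn (q 3 * q 2)) • ω ![br (X 0) (X 3), X 1, X 2, X 4] +
      (sgn (q 4 * q 1) * sgn (q 4 * q 2) * sgn (q 4 * q 3)) •
        ω ![br (X 0) (X 4), X 1, X 2, X 3] -
      (sgn (q 1 * q 0) * sgn (q 2 * q 0)) • ω ![br (X 1) (X 2), X 0, X 3, X 4] +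
      (sgn (q 1 * q 0) * sgn (q 3 * q 0) * sgn (q 3 * q 2)) •
        ω ![br (X 1) (X 3), X 0, X 2, X 4] -
      (sgn (q 1 * q 0) * sgn (q 4 * q 0) * sgn (q 4 * q 2) * sgn (q 4 * q 3)) •
        ω ![br (X 1) (X 4), X 0, X 2, X 3] -
      (sgn (q 2 * q 0) * sgn (q 2 * q 1) * sgn (q 3 * q 0) * sgn (q 3 * q 1)) •
        ω ![br (X 2) (X 3), X 0, X 1, X 4] +
      (sgn (q 2 * q 0) * sgn (q 2 * q 1) * sgn (q 4 * q 0) * sgn (q 4 * q 1) * sgn (q 4 * q 3)) •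
        ω ![br (X 2) (X 4), X 0, X 1, X 3] -
      (sgn (q 3 * q 0) * sgn (q 3 * q 1) * sgn (q 3 * q 2) * sgn (q 4 * q 0) * sgn (q 4 * q 1) *
        sgn (q 4 * q 2)) • ω ![br (X 3) (X 4), X 0, X 1, X 2] := by
  have hcons : ∀ (b : g) (f : Fin 3 → g), (Fin.cons b f : Fin 4 → g) = ![b, f 0, f 1, f 2] :=
    fun b f => by
      rw [← FinVec.etaExpand_eq f]
      rfl
  rw [coboundary_eq_sum_ite]
  simp [Fin.sum_univ_succ, Fin.prod_univ_succ, Fin.succAbove, hcons]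
  module

theorem coboundary_comp {br : g → g → g} {br' : g' → g' → g'} {ρ : g → R → R} {ρ' : g' → R' → R'}
    (h : g →ₗ[ℝ] g') (f : R' →ₗ[ℝ] R) (hbr : ∀ x y, h (br x y) = br' (h x) (h y))
    (hρ : ∀ x r, f (ρ' (h x) r) = ρ x (f r)) (p : ZMod 2) {n : ℕ}
    (ω : MultilinearMap ℝ (fun _ : Fin (n + 1) => g') R') (q : Fin (n + 2) → ZMod 2)
    (X : Fin (n + 2) → g) :
    coboundary br ρ p (f.compMultilinearMap (ω.compLinearMap fun _ => h)) q X =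
      f (coboundary br' ρ' p ω q fun a => h (X a)) := by
  have hcons : ∀ (y : g) (z : Fin n → g),
      (fun a => h (Fin.cons (α := fun _ => g) y z a)) = Fin.cons (h y) fun a => h (z a) :=
    fun y z => funext <| Fin.cases rfl fun _ => rfl
  simp only [coboundary, map_add, map_sum, map_smul, hρ, apply_ite f, map_zero,
    LinearMap.compMultilinearMap_apply, MultilinearMap.compLinearMap_apply, hcons, hbr]

theorem not_isCoboundary_of_commuting {G : ZMod 2 → Submodule ℝ g} {S : ZMod 2 → Submodule ℝ R}
    {br : g → g → g} {n : ℕ} {ω : MultilinearMap ℝ (fun _ : Fin (n + 2) => g) R}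
    (q : Fin (n + 2) → ZMod 2) (X : Fin (n + 2) → g) (hX : ∀ i, X i ∈ G (q i))
    (hbr : ∀ i j, i < j → br (X i) (X j) = 0) (hω : ω X ≠ 0) :
    ¬ IsCoboundary G S br (fun _ _ => 0) ω := by
  rintro ⟨θ, -, h⟩
  refine hω ((h q X hX).trans (Finset.sum_eq_zero fun p _ => ?_))
  simp only [coboundary, smul_zero, Finset.sum_const_zero, zero_add]
  refine Finset.sum_eq_zero fun j _ => Finset.sum_eq_zero fun i _ => ?_
  split_ifs with hij
  · rw [(θ p).map_coord_zero 0 (hbr _ _ hij), smul_zero]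
  · rfl

end Coboundary

section LieSuperalgebra

variable {L : Type} [AddCommGroup L] [Module ℝ L] {G : ZMod 2 → Submodule ℝ L}
  {br : L →ₗ[ℝ] L →ₗ[ℝ] L}

theorem IsLieSuperalgebra.toMultilinear_perm (hL : IsLieSuperalgebra G br) (q : Fin 2 → ZMod 2)
    (x : Fin 2 → L) (hx : ∀ a, x a ∈ G (q a)) (σ : Equiv.Perm (Fin 2)) :
    toMultilinear br (fun a => x (σ a)) = chi σ q • toMultilinear br x := by
  refine skew_of_adjacent G (fun i q x hx => ?_) q x hx σ
  obtain rfl : i = 0 := Subsingleton.elim _ _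
  have hskew := hL.skew _ _ _ (hx 1) _ (hx 0)
  rwa [mul_comm] at hskew

theorem IsLieSuperalgebra.coboundary_toMultilinear (hL : IsLieSuperalgebra G br)
    (q : Fin 3 → ZMod 2) (x : Fin 3 → L) (hx : ∀ a, x a ∈ G (q a)) :
    coboundary (fun y z => br y z) (fun _ _ => 0) 0 (toMultilinear br) q x = 0 := by
  have hskew₀ := hL.skew _ _ _ (hL.bracket_mem _ _ _ (hx 1) _ (hx 2)) _ (hx 0)
  have hskew₁ := hL.skew _ _ _ (hL.bracket_mem _ _ _ (hx 0) _ (hx 2)) _ (hx 1)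
  rw [coboundary_two]
  change -br (br (x 0) (x 1)) (x 2) + sgn (q 2 * q 1) • br (br (x 0) (x 2)) (x 1) -
    (sgn (q 1 * q 0) * sgn (q 2 * q 0)) • br (br (x 1) (x 2)) (x 0) = 0
  rw [hskew₀, hskew₁, hL.jacobi _ _ _ _ (hx 0) _ (hx 1) _ (hx 2), add_mul, add_mul, sgn_add,
    sgn_add, mul_comm (q 0) (q 1)]
  have h₁₀ := sgn_mul_self (q 1 * q 0)
  have h₂₀ := sgn_mul_self (q 2 * q 0)
  have h₂₁ := sgn_mul_self (q 2 * q 1)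
  generalize sgn (q 1 * q 0) = a at *
  generalize sgn (q 2 * q 0) = b at *
  generalize sgn (q 2 * q 1) = c at *
  match_scalars
  · linear_combination b * b * h₁₀ + h₂₀
  · linear_combination -a * h₂₁ + a * a * a * h₂₀ + a * h₁₀

end LieSuperalgebra

/-! ## Direct sum decompositions -/

section Internal

variable {ι κ M N : Type*} [DecidableEq ι] [DecidableEq κ] [AddCommGroup M] [Module ℝ M]
  [AddCommGroup N] [Module ℝ N]

theorem isInternal_of_isInternal_comp {f : ι → κ} {A : κ → Submodule ℝ M}
    (hA : ∀ k ∉ Set.range f, A k = ⊥)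
    (h : DirectSum.IsInternal fun i => A (f i)) : DirectSum.IsInternal A := by
  refine DirectSum.isInternal_submodule_of_iSupIndep_of_iSup_eq_top (fun k => ?_)
    (eq_top_iff.mpr (h.submodule_iSup_eq_top.symm.le.trans (iSup_comp_le A f)))
  by_cases hk : k ∈ Set.range f
  · obtain ⟨i, rfl⟩ := hk
    refine (h.submodule_iSupIndep i).mono_right (iSup₂_le fun k hk => ?_)
    by_cases hk' : k ∈ Set.range f
    · obtain ⟨j, rfl⟩ := hk'
      exact le_iSup₂_of_le j (fun hji => hk (congrArg f hji)) le_rfl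
    · exact (hA k hk').le.trans bot_le
  · rw [hA k hk]
    exact disjoint_bot_left

theorem isInternal_prod {A : ι → Submodule ℝ M} {B : ι → Submodule ℝ N}
    (hA : DirectSum.IsInternal A) (hB : DirectSum.IsInternal B) :
    DirectSum.IsInternal fun i => (A i).prod (B i) := by
  refine DirectSum.isInternal_submodule_of_iSupIndep_of_iSup_eq_top (fun i => ?_)
    (eq_top_iff.mpr fun x _ => ?_)
  · have hle : ⨆ (j) (_ : j ≠ i), (A j).prod (B j) ≤
        (⨆ (j) (_ : j ≠ i), A j).prod (⨆ (j) (_ : j ≠ i), B j) :=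
      iSup₂_le fun j hj => Submodule.prod_mono (le_iSup₂_of_le j hj le_rfl)
        (le_iSup₂_of_le j hj le_rfl)
    refine Submodule.disjoint_def.mpr fun x hx hx' => Prod.ext ?_ ?_
    · exact Submodule.disjoint_def.mp (hA.submodule_iSupIndep i) _ hx.1 (hle hx').1
    · exact Submodule.disjoint_def.mp (hB.submodule_iSupIndep i) _ hx.2 (hle hx').2
  · have hinl : ⨆ i, A i ≤ (⨆ i, (A i).prod (B i)).comap (LinearMap.inl ℝ M N) :=
      iSup_le fun i y hy => Submodule.mem_iSup_of_mem i ⟨hy, zero_mem _⟩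
    have hinr : ⨆ i, B i ≤ (⨆ i, (A i).prod (B i)).comap (LinearMap.inr ℝ M N) :=
      iSup_le fun i y hy => Submodule.mem_iSup_of_mem i ⟨zero_mem _, hy⟩
    rw [hA.submodule_iSup_eq_top] at hinl
    rw [hB.submodule_iSup_eq_top] at hinr
    have hx : x = LinearMap.inl ℝ M N x.1 + LinearMap.inr ℝ M N x.2 := by ext <;> simp
    rw [hx]
    exact add_mem (hinl Submodule.mem_top) (hinr Submodule.mem_top)

end Internal

/-! ## Lie superalgebras and their extensions as `L_∞`-superalgebras -/

namespace LInftyData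

section OfLie

variable {L : Type} [AddCommGroup L] [Module ℝ L] {G : ZMod 2 → Submodule ℝ L}
  {br : L →ₗ[ℝ] L →ₗ[ℝ] L}

theorem ofLie_grading_zero (q : ZMod 2) : (ofLie G br).grading (0, q) = G q :=
  rfl

theorem ofLie_grading_of_ne {d : ℤ × ZMod 2} (hd : d.1 ≠ 0) : (ofLie G br).grading d = ⊥ :=
  if_neg hd

theorem ofLie_l_of_ne {k : ℕ} (hk : k ≠ 2) : (ofLie G br).l k = 0 := by
  match k, hk with
  | 0, _ => rfl
  | 1, _ => rfl
  | _ + 3, _ => rfl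

theorem mem_of_mem_ofLie_grading {d : ℤ × ZMod 2} {x : L} (hx : x ∈ (ofLie G br).grading d) :
    x ∈ G (grade d) := by
  obtain ⟨p, q⟩ := d
  rcases eq_or_ne p 0 with rfl | hp
  · rwa [ofLie_grading_zero, ← zero_add q, ← Int.cast_zero] at hx
  · rw [ofLie_grading_of_ne hp, Submodule.mem_bot] at hx
    exact hx ▸ zero_mem _

theorem ofLie_isInternal (hG : DirectSum.IsInternal G) :
    DirectSum.IsInternal (ofLie G br).grading := by
  refine isInternal_of_isInternal_comp (f := fun q : ZMod 2 => ((0 : ℤ), q))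
    (fun d hd => ofLie_grading_of_ne fun h => hd ⟨d.2, ?_⟩) hG
  rw [← h]

theorem ofLie_l_mem (hL : IsLieSuperalgebra G br) {k : ℕ} (d : Fin k → ℤ × ZMod 2) (x : Fin k → L)
    (hx : ∀ a, x a ∈ (ofLie G br).grading (d a)) :
    (ofLie G br).l k x ∈ (ofLie G br).grading (∑ a, (d a).1 + ((k : ℤ) - 2), ∑ a, (d a).2) := by
  rcases eq_or_ne k 2 with rfl | hk
  · by_cases hd : ∀ a, (d a).1 = 0
    · have hx' : ∀ a, x a ∈ G (d a).2 := fun a => by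
        rw [← ofLie_grading_zero (G := G) (br := br), ← hd a]
        exact hx a
      rw [Finset.sum_eq_zero fun a _ => hd a, Fin.sum_univ_two]
      exact hL.bracket_mem _ _ _ (hx' 0) _ (hx' 1)
    · push Not at hd
      obtain ⟨a, ha⟩ := hd
      have hxa := hx a
      rw [ofLie_grading_of_ne ha, Submodule.mem_bot] at hxa
      rw [((ofLie G br).l 2).map_coord_zero a hxa]
      exact zero_mem _
  · rw [ofLie_l_of_ne hk]
    exact zero_mem _

theorem ofLie_l_perm (hL : IsLieSuperalgebra G br) {k : ℕ} (d : Fin k → ℤ × ZMod 2) (x : Fin k → L)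
    (hx : ∀ a, x a ∈ (ofLie G br).grading (d a)) (σ : Equiv.Perm (Fin k)) :
    (ofLie G br).l k (fun a => x (σ a)) = chi σ (fun a => grade (d a)) • (ofLie G br).l k x := by
  rcases eq_or_ne k 2 with rfl | hk
  · exact hL.toMultilinear_perm _ _ (fun a => mem_of_mem_ofLie_grading (hx a)) σ
  · rw [ofLie_l_of_ne hk]
    exact (smul_zero _).symm

theorem ofLie_jacobiTerm (hL : IsLieSuperalgebra G br) {i m : ℕ} (d : Fin (i + m) → ℤ × ZMod 2)
    (x : Fin (i + m) → L) (hx : ∀ a, x a ∈ (ofLie G br).grading (d a)) :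
    (ofLie G br).jacobiTerm i m d x = 0 := by
  rcases eq_or_ne i 2 with rfl | hi
  · rcases eq_or_ne m 1 with rfl | hm
    · refine (jacobiTerm_two (ofLie G br) (n := 1) d x).trans (neg_eq_zero.mpr ?_)
      exact hL.coboundary_toMultilinear _ _ fun a => mem_of_mem_ofLie_grading (hx a)
    · refine Finset.sum_eq_zero fun σ _ => ?_
      rw [ofLie_l_of_ne (by omega), zero_apply, smul_zero, ite_self]
  · refine Finset.sum_eq_zero fun σ _ => ?_
    rw [ofLie_l_of_ne hi, ((ofLie G br).l (m + 1)).map_coord_zero 0 rfl, smul_zero, ite_self]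

theorem ofLie_isLInftySuperalgebra (hL : IsLieSuperalgebra G br) :
    IsLInftySuperalgebra (ofLie G br) where
  internal := ofLie_isInternal hL.internal
  nonneg _ _ hp := ofLie_grading_of_ne hp.ne
  l_zero := rfl
  degree _ := ofLie_l_mem hL
  antisymm _ := ofLie_l_perm hL
  jacobi _ _ _ hx := Finset.sum_eq_zero fun _ _ => ofLie_jacobiTerm hL _ _ fun _ => hx _

end OfLie

section BTwoR

theorem bTwoR_grading_two (q : ZMod 2) : bTwoR.grading (2, q) = evenGrading ℝ q := by
  simp [bTwoR, evenGrading]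

theorem bTwoR_grading_of_ne {d : ℤ × ZMod 2} (hd : d.1 ≠ 2) : bTwoR.grading d = ⊥ :=
  if_neg fun h => hd (congrArg Prod.fst h)

theorem bTwoR_isInternal : DirectSum.IsInternal bTwoR.grading := by
  refine isInternal_of_isInternal_comp (f := fun _ : Unit => ((2 : ℤ), (0 : ZMod 2)))
    (fun d hd => if_neg fun h => hd ⟨(), h.symm⟩) ?_
  exact DirectSum.isInternal_submodule_of_iSupIndep_of_iSup_eq_top (iSupIndep_subsingleton _)
    ciSup_const

theorem bTwoR_isLInftySuperalgebra : IsLInftySuperalgebra bTwoR where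
  internal := bTwoR_isInternal
  nonneg _ _ hp := bTwoR_grading_of_ne (by omega)
  l_zero := rfl
  degree _ _ _ _ := zero_mem _
  antisymm _ _ _ _ _ := (smul_zero _).symm
  jacobi _ _ _ _ := Finset.sum_eq_zero fun _ _ => Finset.sum_eq_zero fun _ _ => by
    rw [bTwoR, zero_apply, smul_zero, ite_self]

end BTwoR

theorem map_jacobiTerm {L L' : Type} [AddCommGroup L] [Module ℝ L] [AddCommGroup L']
    [Module ℝ L'] {A : LInftyData L} {B : LInftyData L'} (f : L →ₗ[ℝ] L')
    (hf : ∀ k x, f (A.l k x) = B.l k fun a => f (x a)) {i m : ℕ} (d : Fin (i + m) → ℤ × ZMod 2)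
    (x : Fin (i + m) → L) :
    f (A.jacobiTerm i m d x) = B.jacobiTerm i m d fun a => f (x a) := by
  rw [jacobiTerm, jacobiTerm, map_sum]
  refine Finset.sum_congr rfl fun σ _ => ?_
  rw [apply_ite f, map_smul, map_zero, hf, ← hf i]
  congr 3
  exact funext <| Fin.cases rfl fun _ => rfl

section Extension

variable {L : Type} [AddCommGroup L] [Module ℝ L] {G : ZMod 2 → Submodule ℝ L}
  {br : L →ₗ[ℝ] L →ₗ[ℝ] L} {ω : MultilinearMap ℝ (fun _ : Fin 4 => L) ℝ}

theorem extension_grading (d : ℤ × ZMod 2) : (extension G br ω).grading d =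
    ((ofLie G br).grading d).prod (bTwoR.grading d) := by
  by_cases h₀ : d.1 = 0
  · rw [bTwoR_grading_of_ne (by omega)]
    simp [extension, ofLie, h₀]
  · rw [ofLie_grading_of_ne h₀]
    simp only [extension, bTwoR, h₀, if_false]
    split_ifs
    · rfl
    · exact Submodule.prod_bot.symm

theorem mem_extension_grading {d : ℤ × ZMod 2} {x : L × ℝ} :
    x ∈ (extension G br ω).grading d ↔
      x.1 ∈ (ofLie G br).grading d ∧ x.2 ∈ bTwoR.grading d := by
  rw [extension_grading, Submodule.mem_prod]

theorem extension_grading_of_ne {d : ℤ × ZMod 2} (h₀ : d.1 ≠ 0) (h₂ : d.1 ≠ 2) :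
    (extension G br ω).grading d = ⊥ := by
  rw [extension_grading, ofLie_grading_of_ne h₀, bTwoR_grading_of_ne h₂, Submodule.prod_bot]

theorem extension_isInternal (hG : DirectSum.IsInternal G) :
    DirectSum.IsInternal (extension G br ω).grading := by
  rw [funext (extension_grading (G := G) (br := br) (ω := ω))]
  exact isInternal_prod (ofLie_isInternal hG) bTwoR_isInternal

theorem extension_l_fst (k : ℕ) (x : Fin k → L × ℝ) :
    ((extension G br ω).l k x).1 = (ofLie G br).l k fun a => (x a).1 := by
  match k with
  | 0 => rfl
  | 1 => rfl
  | 2 => rfl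
  | 3 => rfl
  | 4 => rfl
  | _ + 5 => rfl

theorem extension_l_four_snd (x : Fin 4 → L × ℝ) :
    ((extension G br ω).l 4 x).2 = ω fun a => (x a).1 :=
  rfl

theorem extension_l_snd_of_ne {k : ℕ} (hk : k ≠ 4) (x : Fin k → L × ℝ) :
    ((extension G br ω).l k x).2 = 0 := by
  match k, hk with
  | 0, _ => rfl
  | 1, _ => rfl
  | 2, _ => rfl
  | 3, _ => rfl
  | _ + 5, _ => rfl

theorem extension_l_mem (hL : IsLieSuperalgebra G br) (hω : IsCochain G (evenGrading ℝ) 0 ω)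
    {k : ℕ} (d : Fin k → ℤ × ZMod 2) (x : Fin k → L × ℝ)
    (hx : ∀ a, x a ∈ (extension G br ω).grading (d a)) :
    (extension G br ω).l k x ∈
      (extension G br ω).grading (∑ a, (d a).1 + ((k : ℤ) - 2), ∑ a, (d a).2) := by
  have hx' : ∀ a, (x a).1 ∈ (ofLie G br).grading (d a) := fun a =>
    (mem_extension_grading.mp (hx a)).1
  refine mem_extension_grading.mpr ⟨extension_l_fst k x ▸ ofLie_l_mem hL d _ hx', ?_⟩
  rcases eq_or_ne k 4 with rfl | hk
  · rw [extension_l_four_snd]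
    by_cases hd : ∀ a, (d a).1 = 0
    · have hω' := hω.parity (fun a => (d a).2) (fun a => (x a).1) fun a => by
        rw [← ofLie_grading_zero (G := G) (br := br), ← hd a]
        exact hx' a
      rw [Finset.sum_eq_zero fun a _ => hd a]
      rwa [zero_add, ← bTwoR_grading_two] at hω'
    · push Not at hd
      obtain ⟨a, ha⟩ := hd
      have hxa := hx' a
      rw [ofLie_grading_of_ne ha, Submodule.mem_bot] at hxa
      rw [ω.map_coord_zero a hxa]
      exact zero_mem _
  · rw [extension_l_snd_of_ne hk]
    exact zero_mem _

theorem extension_l_perm (hL : IsLieSuperalgebra G br) (hω : IsCochain G (evenGrading ℝ) 0 ω)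
    {k : ℕ} (d : Fin k → ℤ × ZMod 2) (x : Fin k → L × ℝ)
    (hx : ∀ a, x a ∈ (extension G br ω).grading (d a)) (σ : Equiv.Perm (Fin k)) :
    (extension G br ω).l k (fun a => x (σ a)) =
      chi σ (fun a => grade (d a)) • (extension G br ω).l k x := by
  have hx' : ∀ a, (x a).1 ∈ (ofLie G br).grading (d a) := fun a =>
    (mem_extension_grading.mp (hx a)).1
  refine Prod.ext ?_ ?_
  · rw [Prod.smul_fst, extension_l_fst, extension_l_fst]
    exact ofLie_l_perm hL d _ hx' σ
  · rw [Prod.smul_snd]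
    rcases eq_or_ne k 4 with rfl | hk
    · exact hω.skew _ _ (fun a => mem_of_mem_ofLie_grading (hx' a)) σ
    · rw [extension_l_snd_of_ne hk, extension_l_snd_of_ne hk, smul_zero]

theorem extension_jacobiTerm_snd
    (hω : IsEvenCocycle G (evenGrading ℝ) (fun x y => br x y) (fun _ _ => 0) ω) {i m : ℕ}
    (d : Fin (i + m) → ℤ × ZMod 2) (x : Fin (i + m) → L × ℝ)
    (hx : ∀ a, (x a).1 ∈ (ofLie G br).grading (d a)) :
    ((extension G br ω).jacobiTerm i m d x).2 = 0 := by
  by_cases him : i = 2 ∧ m = 3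
  · obtain ⟨rfl, rfl⟩ := him
    have hcomp := coboundary_comp (br := fun y z => (extension G br ω).l 2 ![y, z])
      (br' := fun y z => br y z) (ρ := fun _ _ => 0) (ρ' := fun _ _ => 0) (LinearMap.fst ℝ L ℝ)
      (LinearMap.inr ℝ L ℝ) (fun _ _ => rfl) (fun _ _ => rfl) 0 ω (fun a => grade (d a)) x
    have hcoboundary := hω.2 _ _ fun a => mem_of_mem_ofLie_grading (hx a)
    exact congrArg Prod.snd ((jacobiTerm_two (extension G br ω) (n := 3) d x).trans
      (neg_eq_zero.mpr (hcomp.trans ((congrArg _ hcoboundary).trans (map_zero _)))))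
  · rw [jacobiTerm, Prod.snd_sum]
    refine Finset.sum_eq_zero fun σ _ => ?_
    rw [apply_ite Prod.snd, Prod.smul_snd]
    rcases eq_or_ne m 3 with rfl | hm
    · rw [extension_l_four_snd, ω.map_coord_zero 0, smul_zero]
      · exact ite_self _
      · rw [Fin.cons_zero, extension_l_fst, ofLie_l_of_ne fun hi => him ⟨hi, rfl⟩]
        rfl
    · rw [extension_l_snd_of_ne (by omega), smul_zero]
      exact ite_self _

theorem extension_isLieNSuperalgebra (hL : IsLieSuperalgebra G br)
    (hω : IsEvenCocycle G (evenGrading ℝ) (fun x y => br x y) (fun _ _ => 0) ω) :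
    IsLieNSuperalgebra 3 (extension G br ω) where
  left :=
    { internal := extension_isInternal hL.internal
      nonneg := fun p _ hp => extension_grading_of_ne hp.ne (by omega)
      l_zero := rfl
      degree := fun _ => extension_l_mem hL hω.1
      antisymm := fun _ => extension_l_perm hL hω.1
      jacobi := fun n d x hx => Finset.sum_eq_zero fun c _ => by
        have hx' : ∀ a, (x a).1 ∈ (ofLie G br).grading (d a) := fun a =>
          (mem_extension_grading.mp (hx a)).1
        refine Prod.ext ?_ (extension_jacobiTerm_snd hω _ _ fun a => hx' _)
        exact (map_jacobiTerm (LinearMap.fst ℝ L ℝ) extension_l_fst _ _).trans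
          (ofLie_jacobiTerm hL _ _ fun a => hx' _) }
  right p _ hp := extension_grading_of_ne (by omega) (by omega)

theorem extension_isShortExact (hL : IsLieSuperalgebra G br)
    (hω : IsEvenCocycle G (evenGrading ℝ) (fun x y => br x y) (fun _ _ => 0) ω) :
    IsShortExact bTwoR (extension G br ω) (ofLie G br) (LinearMap.inr ℝ L ℝ)
      (LinearMap.fst ℝ L ℝ) where
  left := bTwoR_isLInftySuperalgebra
  middle := (extension_isLieNSuperalgebra hL hω).1
  right := ofLie_isLInftySuperalgebra hL
  hom_left := by
    refine ⟨fun d x hx => mem_extension_grading.mpr ⟨zero_mem _, hx⟩, fun k x => Prod.ext ?_ ?_⟩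
    · rw [extension_l_fst]
      rcases eq_or_ne k 2 with rfl | hk
      · exact ((toMultilinear br).map_coord_zero 0 rfl).symm
      · rw [ofLie_l_of_ne hk]
        rfl
    · rcases eq_or_ne k 4 with rfl | hk
      · exact (ω.map_coord_zero 0 rfl).symm
      · exact (extension_l_snd_of_ne hk _).symm
  hom_right := ⟨fun _ _ hx => (mem_extension_grading.mp hx).1, extension_l_fst⟩
  injective := LinearMap.inr_injective
  exact := LinearMap.exact_iff.mpr (LinearMap.range_inr ℝ L ℝ).symm
  surjective := LinearMap.fst_surjective

theorem isCoboundary_of_isExact_extension (h : IsExact 2 (extension G br ω)) :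
    IsCoboundary G (evenGrading ℝ) (fun x y => br x y) (fun _ _ => 0) ω := by
  obtain ⟨-, -, θ, hθ, hdθ⟩ := h
  have hmem : ∀ {q x}, x ∈ G q → ((x, 0) : L × ℝ) ∈ (extension G br ω).grading (0, q) :=
    fun hx => mem_extension_grading.mpr ⟨hx, zero_mem _⟩
  refine ⟨fun p => (LinearMap.snd ℝ L ℝ).compMultilinearMap
    ((θ p).compLinearMap fun _ => LinearMap.inl ℝ L ℝ), fun p => ⟨fun q x hx => ?_,
    fun q x hx σ => ?_⟩, fun q X hX => ?_⟩
  · rw [← bTwoR_grading_two]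
    exact (mem_extension_grading.mp ((hθ p).parity q _ fun a => hmem (hx a))).2
  · exact congrArg Prod.snd ((hθ p).skew q _ (fun a => hmem (hx a)) σ)
  · refine (congrArg Prod.snd (hdθ q _ fun a => hmem (hX a))).trans ?_
    rw [Prod.snd_sum]
    exact Finset.sum_congr rfl fun p _ => (coboundary_comp
      (br' := fun y z => (extension G br ω).l 2 ![y, z])
      (ρ' := fun y z => (extension G br ω).l 2 ![y, z]) (LinearMap.inl ℝ L ℝ)
      (LinearMap.snd ℝ L ℝ) (fun _ _ => rfl) (fun _ _ => rfl) p (θ p) q X).symm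

end Extension

end LInftyData

/-! ## The form `β` on arbitrary arguments -/

theorem sign_pairFirst {n : ℕ} (i : Fin (n + 1)) (j : Fin (n + 2)) :
    Equiv.Perm.sign (pairFirst i j) = -(-1) ^ ((i : ℕ) + (j : ℕ)) := by
  rw [pairFirst, Equiv.Perm.sign_mul, Equiv.Perm.sign_mul, Equiv.Perm.sign_symm,
    Equiv.Perm.decomposeFin.symm_sign, if_pos rfl, Equiv.Perm.sign_symm, Fin.sign_cycleRange,
    Fin.sign_cycleRange, Equiv.Perm.sign_swap Fin.zero_ne_one, one_mul, mul_neg_one, pow_add,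
    mul_comm]

section Beta

variable {K : Type} [NormedDivisionAlgebra K]

theorem betaAux_apply (t : Fin 4 → T K) :
    betaAux K t = cliffordForm (t 2).1 (t 3).1 (t 0).2 (t 1).2 :=
  rfl

theorem beta_eq_sum (t : Fin 4 → T K) :
    beta K t = ∑ j : Fin 4, ∑ i : Fin 3, if i.castSucc < j then
      -(-1) ^ ((i : ℕ) + (j : ℕ)) * cliffordForm (t (j.succAbove (i.succAbove 0))).1
        (t (j.succAbove (i.succAbove 1))).1 (t i.castSucc).2 (t j).2 else 0 := by
  have h := sum_isUnshuffle_two (n := 2) fun σ : Equiv.Perm (Fin 4) =>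
    ((Equiv.Perm.sign σ : ℤ) : ℝ) • (betaAux K).domDomCongr σ
  refine (congrArg (· t) h).trans ?_
  simp only [sum_apply]
  refine Finset.sum_congr rfl fun j _ => Finset.sum_congr rfl fun i _ => ?_
  split_ifs with hij
  · have h₀ : pairFirst i j 0 = i.castSucc :=
      (pairFirst_zero i j).trans (Fin.succAbove_of_castSucc_lt j i hij)
    have h₂ : pairFirst i j 2 = j.succAbove (i.succAbove 0) := pairFirst_succ_succ i j 0
    have h₃ : pairFirst i j 3 = j.succAbove (i.succAbove 1) := pairFirst_succ_succ i j 1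
    change ((Equiv.Perm.sign (pairFirst i j) : ℤ) : ℝ) *
      betaAux K (fun a => t (pairFirst i j a)) = _
    rw [betaAux_apply, sign_pairFirst, h₀, pairFirst_one, h₂, h₃]
    push_cast
    rfl
  · rfl

theorem beta_eq (t : Fin 4 → T K) :
    beta K t = cliffordForm (t 2).1 (t 3).1 (t 0).2 (t 1).2 -
      cliffordForm (t 1).1 (t 3).1 (t 0).2 (t 2).2 + cliffordForm (t 1).1 (t 2).1 (t 0).2 (t 3).2 +
      cliffordForm (t 0).1 (t 3).1 (t 1).2 (t 2).2 - cliffordForm (t 0).1 (t 2).1 (t 1).2 (t 3).2 +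
      cliffordForm (t 0).1 (t 1).1 (t 2).2 (t 3).2 := by
  rw [beta_eq_sum]
  simp [Fin.sum_univ_succ, Fin.succAbove]
  ring

end Beta

/-! ## The Poincaré superalgebra -/

section Poincare

variable {K : Type} [NormedDivisionAlgebra K]

theorem mem_sisoGrading_zero {x : Siso K} :
    x ∈ sisoGrading K 0 ↔ ∃ (X : so K) (A : Vec K), x = (X, A, 0) :=
  ⟨fun hx => ⟨x.1, x.2.1, Prod.ext rfl (Prod.ext rfl hx.2.2)⟩, by
    rintro ⟨X, A, rfl⟩
    exact ⟨trivial, trivial, rfl⟩⟩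

theorem mem_sisoGrading_one {x : Siso K} :
    x ∈ sisoGrading K 1 ↔ ∃ Ψ : Spinor K, x = (0, 0, Ψ) :=
  ⟨fun hx => ⟨x.2.2, Prod.ext hx.1 (Prod.ext hx.2.1 rfl)⟩, by
    rintro ⟨Ψ, rfl⟩
    exact ⟨rfl, rfl, trivial⟩⟩

theorem even_mem_sisoGrading (X : so K) (A : Vec K) : ((X, A, 0) : Siso K) ∈ sisoGrading K 0 :=
  mem_sisoGrading_zero.mpr ⟨X, A, rfl⟩

theorem odd_mem_sisoGrading (Ψ : Spinor K) : ((0, 0, Ψ) : Siso K) ∈ sisoGrading K 1 :=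
  mem_sisoGrading_one.mpr ⟨Ψ, rfl⟩

theorem even_or_odd_of_mem_sisoGrading {q : ZMod 2} {x : Siso K} (hx : x ∈ sisoGrading K q) :
    (q = 0 ∧ ∃ (X : so K) (A : Vec K), x = (X, A, 0)) ∨
      (q = 1 ∧ ∃ Ψ : Spinor K, x = (0, 0, Ψ)) := by
  rcases zmod_two_eq_zero_or_one q with rfl | rfl
  · exact .inl ⟨rfl, mem_sisoGrading_zero.mp hx⟩
  · exact .inr ⟨rfl, mem_sisoGrading_one.mp hx⟩

theorem sisoBracket_apply (x y : Siso K) : sisoBracket K x y = (soBracket K x.1 y.1,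
    x.1.1 y.2.1 - y.1.1 x.2.1 + dot K x.2.2 y.2.2, spin K x.1 y.2.2 - spin K y.1 x.2.2) :=
  Prod.ext rfl (Prod.ext rfl (add_zero _))

theorem sisoBracket_even_even (X Y : so K) (A C : Vec K) :
    sisoBracket K (X, A, 0) (Y, C, 0) = (soBracket K X Y, X.1 C - Y.1 A, 0) := by
  simp [sisoBracket_apply]

theorem sisoBracket_even_odd (X : so K) (A : Vec K) (Ψ : Spinor K) :
    sisoBracket K (X, A, 0) (0, 0, Ψ) = (0, 0, spin K X Ψ) := by
  simp [sisoBracket_apply]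

theorem sisoBracket_odd_even (X : so K) (A : Vec K) (Ψ : Spinor K) :
    sisoBracket K (0, 0, Ψ) (X, A, 0) = (0, 0, -spin K X Ψ) := by
  simp [sisoBracket_apply]

theorem sisoBracket_odd_odd (Ψ Φ : Spinor K) :
    sisoBracket K (0, 0, Ψ) (0, 0, Φ) = (0, dot K Ψ Φ, 0) := by
  simp [sisoBracket_apply]

theorem soBracket_apply (X Y : so K) (A : Vec K) :
    (soBracket K X Y).1 A = X.1 (Y.1 A) - Y.1 (X.1 A) := rfl

theorem soBracket_skew (X Y : so K) : soBracket K X Y = -soBracket K Y X :=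
  Subtype.ext (neg_sub _ _).symm

theorem soBracket_jacobi (X Y Z : so K) : soBracket K X (soBracket K Y Z) =
    soBracket K (soBracket K X Y) Z + soBracket K Y (soBracket K X Z) :=
  Subtype.ext <| LinearMap.ext fun A => by
    simp only [soBracket_apply, Submodule.coe_add, LinearMap.add_apply, map_sub]
    abel

theorem spin_soBracket_apply (X Y : so K) (Ψ : Spinor K) :
    spin K (soBracket K X Y) Ψ = spin K X (spin K Y Ψ) - spin K Y (spin K X Ψ) := by
  rw [spin_soBracket]
  rfl

theorem sisoGrading_isInternal : DirectSum.IsInternal (sisoGrading K) := by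
  have hcompl : IsCompl (sisoGrading K 0) (sisoGrading K 1) := by
    refine ⟨Submodule.disjoint_def.mpr fun x hx₀ hx₁ => ?_, codisjoint_iff.mpr ?_⟩
    · exact Prod.ext hx₁.1 (Prod.ext hx₁.2.1 hx₀.2.2)
    · refine Submodule.eq_top_iff'.mpr fun x => Submodule.mem_sup.mpr ?_
      exact ⟨_, even_mem_sisoGrading x.1 x.2.1, _, odd_mem_sisoGrading x.2.2, by simp⟩
  refine (DirectSum.isInternal_submodule_iff_isCompl _ zero_ne_one ?_).mpr hcompl
  exact (Set.eq_univ_of_forall fun q => zmod_two_eq_zero_or_one q).symm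

theorem sisoBracket_mem (p q : ZMod 2) (x : Siso K) (hx : x ∈ sisoGrading K p) (y : Siso K)
    (hy : y ∈ sisoGrading K q) : sisoBracket K x y ∈ sisoGrading K (p + q) := by
  rcases even_or_odd_of_mem_sisoGrading hx with ⟨rfl, X, A, rfl⟩ | ⟨rfl, Ψ, rfl⟩ <;>
    rcases even_or_odd_of_mem_sisoGrading hy with ⟨rfl, Y, C, rfl⟩ | ⟨rfl, Φ, rfl⟩
  · exact sisoBracket_even_even X Y A C ▸ even_mem_sisoGrading _ _
  · exact sisoBracket_even_odd X A Φ ▸ odd_mem_sisoGrading _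
  · exact sisoBracket_odd_even Y C Ψ ▸ odd_mem_sisoGrading _
  · exact sisoBracket_odd_odd Ψ Φ ▸ even_mem_sisoGrading _ _

theorem sisoBracket_skew (p q : ZMod 2) (x : Siso K) (hx : x ∈ sisoGrading K p) (y : Siso K)
    (hy : y ∈ sisoGrading K q) : sisoBracket K x y = -(sgn (p * q) • sisoBracket K y x) := by
  rcases even_or_odd_of_mem_sisoGrading hx with ⟨rfl, X, A, rfl⟩ | ⟨rfl, Ψ, rfl⟩ <;>
    rcases even_or_odd_of_mem_sisoGrading hy with ⟨rfl, Y, C, rfl⟩ | ⟨rfl, Φ, rfl⟩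
  · simp [sisoBracket_even_even, sgn_zero, ← soBracket_skew]
  · simp [sisoBracket_even_odd, sisoBracket_odd_even, sgn_zero]
  · simp [sisoBracket_even_odd, sisoBracket_odd_even, sgn_zero]
  · simp [sisoBracket_odd_odd, sgn_one, dot_comm Φ Ψ]

theorem sisoBracket_jacobi (p q r : ZMod 2) (x : Siso K) (hx : x ∈ sisoGrading K p) (y : Siso K)
    (hy : y ∈ sisoGrading K q) (z : Siso K) (hz : z ∈ sisoGrading K r) :
    sisoBracket K x (sisoBracket K y z) = sisoBracket K (sisoBracket K x y) z +
      sgn (p * q) • sisoBracket K y (sisoBracket K x z) := by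
  rcases even_or_odd_of_mem_sisoGrading hx with ⟨rfl, X, A, rfl⟩ | ⟨rfl, Ψ, rfl⟩ <;>
    rcases even_or_odd_of_mem_sisoGrading hy with ⟨rfl, Y, C, rfl⟩ | ⟨rfl, Φ, rfl⟩ <;>
    rcases even_or_odd_of_mem_sisoGrading hz with ⟨rfl, Z, D, rfl⟩ | ⟨rfl, Θ, rfl⟩
  · simp [sisoBracket_even_even, sgn_zero, soBracket_jacobi X, soBracket_apply]
    abel
  · simp [sisoBracket_even_even, sisoBracket_even_odd, sgn_zero, spin_soBracket_apply]
  · simp [sisoBracket_even_even, sisoBracket_even_odd, sisoBracket_odd_even, sgn_zero,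
      spin_soBracket_apply]
    abel
  · simp [sisoBracket_even_even, sisoBracket_even_odd, sisoBracket_odd_odd, sgn_zero, so_dot]
  · simp [sisoBracket_even_even, sisoBracket_even_odd, sisoBracket_odd_even, sgn_zero,
      spin_soBracket_apply]
    abel
  · simp [sisoBracket_even_even, sisoBracket_even_odd, sisoBracket_odd_even,
      sisoBracket_odd_odd, sgn_zero, so_dot]
  · simp [sisoBracket_even_even, sisoBracket_odd_even, sisoBracket_odd_odd, sgn_one, so_dot,
      dot_comm Φ]
  · simp [sisoBracket_even_odd, sisoBracket_odd_even, sisoBracket_odd_odd]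

theorem siso_isLieSuperalgebra : IsLieSuperalgebra (sisoGrading K) (sisoBracket K) where
  internal := sisoGrading_isInternal
  bracket_mem := sisoBracket_mem
  skew := sisoBracket_skew
  jacobi := sisoBracket_jacobi

end Poincare

/-! ## The cocycle `β` -/

section BetaSiso

variable {K : Type} [NormedDivisionAlgebra K]

theorem cliffordForm_zero_left (C : Vec K) (Ψ Φ : Spinor K) : cliffordForm 0 C Ψ Φ = 0 := by
  simp only [map_zero, LinearMap.zero_apply]

theorem cliffordForm_zero_right (A : Vec K) (Ψ Φ : Spinor K) : cliffordForm A 0 Ψ Φ = 0 := by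
  simp only [map_zero, LinearMap.zero_apply]

theorem cliffordForm_apply_zero_left (A C : Vec K) (Φ : Spinor K) :
    cliffordForm A C 0 Φ = 0 := by
  simp only [map_zero, LinearMap.zero_apply]

theorem cliffordForm_apply_zero_right (A C : Vec K) (Ψ : Spinor K) :
    cliffordForm A C Ψ 0 = 0 :=
  map_zero _

theorem cliffordForm_apply_neg_left (A C : Vec K) (Ψ Φ : Spinor K) :
    cliffordForm A C (-Ψ) Φ = -cliffordForm A C Ψ Φ := by
  simp only [map_neg, LinearMap.neg_apply]

theorem cliffordForm_sub_left (A A' C : Vec K) (Ψ Φ : Spinor K) :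
    cliffordForm (A - A') C Ψ Φ = cliffordForm A C Ψ Φ - cliffordForm A' C Ψ Φ := by
  simp only [cliffordForm_apply, map_sub, LinearMap.sub_apply]
  ring

theorem cliffordForm_poincare_invariant (X₀ X₁ X₂ : so K) (A₀ A₁ A₂ : Vec K) (Ψ Φ : Spinor K) :
    cliffordForm (X₀.1 A₁ - X₁.1 A₀) A₂ Ψ Φ - cliffordForm (X₀.1 A₂ - X₂.1 A₀) A₁ Ψ Φ +
      cliffordForm (X₁.1 A₂ - X₂.1 A₁) A₀ Ψ Φ +
      (cliffordForm A₁ A₂ (spin K X₀ Ψ) Φ + cliffordForm A₁ A₂ (spin K X₀ Φ) Ψ) -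
      (cliffordForm A₀ A₂ (spin K X₁ Ψ) Φ + cliffordForm A₀ A₂ (spin K X₁ Φ) Ψ) +
      (cliffordForm A₀ A₁ (spin K X₂ Ψ) Φ + cliffordForm A₀ A₁ (spin K X₂ Φ) Ψ) = 0 := by
  have h₀ := cliffordForm_invariant X₀ A₁ A₂ Ψ Φ
  have h₁ := cliffordForm_invariant X₁ A₀ A₂ Ψ Φ
  have h₂ := cliffordForm_invariant X₂ A₀ A₁ Ψ Φ
  rw [cliffordForm_skew A₁ (X₀.1 A₂), cliffordForm_comm _ _ Ψ (spin K X₀ Φ)] at h₀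
  rw [cliffordForm_skew A₀ (X₁.1 A₂), cliffordForm_comm _ _ Ψ (spin K X₁ Φ)] at h₁
  rw [cliffordForm_skew A₀ (X₂.1 A₁), cliffordForm_comm _ _ Ψ (spin K X₂ Φ)] at h₂
  simp only [cliffordForm_sub_left]
  linarith

theorem betaSiso_eq (x : Fin 4 → Siso K) :
    betaSiso K x = cliffordForm (x 2).2.1 (x 3).2.1 (x 0).2.2 (x 1).2.2 -
      cliffordForm (x 1).2.1 (x 3).2.1 (x 0).2.2 (x 2).2.2 +
      cliffordForm (x 1).2.1 (x 2).2.1 (x 0).2.2 (x 3).2.2 +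
      cliffordForm (x 0).2.1 (x 3).2.1 (x 1).2.2 (x 2).2.2 -
      cliffordForm (x 0).2.1 (x 2).2.1 (x 1).2.2 (x 3).2.2 +
      cliffordForm (x 0).2.1 (x 1).2.1 (x 2).2.2 (x 3).2.2 :=
  beta_eq _

theorem betaSiso_vecCons (a b c d : Siso K) :
    betaSiso K ![a, b, c, d] = cliffordForm c.2.1 d.2.1 a.2.2 b.2.2 -
      cliffordForm b.2.1 d.2.1 a.2.2 c.2.2 + cliffordForm b.2.1 c.2.1 a.2.2 d.2.2 +
      cliffordForm a.2.1 d.2.1 b.2.2 c.2.2 - cliffordForm a.2.1 c.2.1 b.2.2 d.2.2 +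
      cliffordForm a.2.1 b.2.1 c.2.2 d.2.2 :=
  betaSiso_eq _

theorem betaSiso_swap (i : Fin 3) (q : Fin 4 → ZMod 2) (x : Fin 4 → Siso K)
    (hx : ∀ a, x a ∈ sisoGrading K (q a)) :
    betaSiso K (fun a => x (Equiv.swap i.castSucc i.succ a)) =
      -(sgn (q i.castSucc * q i.succ) • betaSiso K x) := by
  rw [betaSiso_eq, betaSiso_eq]
  fin_cases i
  · have hfix : Equiv.swap (0 : Fin 4) 1 2 = 2 ∧ Equiv.swap (0 : Fin 4) 1 3 = 3 := by decide
    rcases even_or_odd_of_mem_sisoGrading (hx 0) with ⟨h₀, X, A, e₀⟩ | ⟨h₀, Ψ, e₀⟩ <;>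
      rcases even_or_odd_of_mem_sisoGrading (hx 1) with ⟨h₁, Y, C, e₁⟩ | ⟨h₁, Φ, e₁⟩
    · simp [hfix, h₀, h₁, e₀, e₁, sgn_zero, cliffordForm_skew C A]
    · simp [hfix, h₀, h₁, e₀, e₁, sgn_zero]
      ring
    · simp [hfix, h₀, h₁, e₀, e₁, sgn_zero]
      ring
    · simp [hfix, h₀, h₁, e₀, e₁, sgn_one, cliffordForm_comm _ _ Φ Ψ]
  · have hfix : Equiv.swap (1 : Fin 4) 2 0 = 0 ∧ Equiv.swap (1 : Fin 4) 2 3 = 3 := by decide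
    rcases even_or_odd_of_mem_sisoGrading (hx 1) with ⟨h₀, X, A, e₀⟩ | ⟨h₀, Ψ, e₀⟩ <;>
      rcases even_or_odd_of_mem_sisoGrading (hx 2) with ⟨h₁, Y, C, e₁⟩ | ⟨h₁, Φ, e₁⟩
    · simp [hfix, h₀, h₁, e₀, e₁, sgn_zero, cliffordForm_skew C A]
    · simp [hfix, h₀, h₁, e₀, e₁, sgn_zero]
      ring
    · simp [hfix, h₀, h₁, e₀, e₁, sgn_zero]
      ring
    · simp [hfix, h₀, h₁, e₀, e₁, sgn_one, cliffordForm_comm _ _ Φ Ψ]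
  · have hfix : Equiv.swap (2 : Fin 4) 3 0 = 0 ∧ Equiv.swap (2 : Fin 4) 3 1 = 1 := by decide
    rcases even_or_odd_of_mem_sisoGrading (hx 2) with ⟨h₀, X, A, e₀⟩ | ⟨h₀, Ψ, e₀⟩ <;>
      rcases even_or_odd_of_mem_sisoGrading (hx 3) with ⟨h₁, Y, C, e₁⟩ | ⟨h₁, Φ, e₁⟩
    · simp [hfix, h₀, h₁, e₀, e₁, sgn_zero, cliffordForm_skew C A]
    · simp [hfix, h₀, h₁, e₀, e₁, sgn_zero]
      ring
    · simp [hfix, h₀, h₁, e₀, e₁, sgn_zero]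
      ring
    · simp [hfix, h₀, h₁, e₀, e₁, sgn_one, cliffordForm_comm _ _ Φ Ψ]

theorem betaSiso_eq_zero_of_sum_ne_zero (q : Fin 4 → ZMod 2) (x : Fin 4 → Siso K)
    (hx : ∀ i, x i ∈ sisoGrading K (q i)) (hq : ∑ i, q i ≠ 0) : betaSiso K x = 0 := by
  rw [Fin.sum_univ_four] at hq
  rw [betaSiso_eq]
  rcases even_or_odd_of_mem_sisoGrading (hx 0) with ⟨h₀, _, _, e₀⟩ | ⟨h₀, _, e₀⟩ <;>
    rcases even_or_odd_of_mem_sisoGrading (hx 1) with ⟨h₁, _, _, e₁⟩ | ⟨h₁, _, e₁⟩ <;>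
    rcases even_or_odd_of_mem_sisoGrading (hx 2) with ⟨h₂, _, _, e₂⟩ | ⟨h₂, _, e₂⟩ <;>
    rcases even_or_odd_of_mem_sisoGrading (hx 3) with ⟨h₃, _, _, e₃⟩ | ⟨h₃, _, e₃⟩ <;>
    rw [h₀, h₁, h₂, h₃] at hq <;> first
    | exact absurd (by decide) hq
    | simp [e₀, e₁, e₂, e₃]

theorem betaSiso_isCochain : IsCochain (sisoGrading K) (evenGrading ℝ) 0 (betaSiso K) where
  parity q x hx := by
    by_cases hq : ∑ i, q i = 0
    · simp [evenGrading, hq]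
    · rw [betaSiso_eq_zero_of_sum_ne_zero q x hx hq]
      exact zero_mem _
  skew q x hx σ := skew_of_adjacent (sisoGrading K) betaSiso_swap q x hx σ

set_option maxHeartbeats 400000 in
-- The 32 distributions of the parities are simplified separately.
theorem betaSiso_cocycle (q : Fin 5 → ZMod 2) (X : Fin 5 → Siso K)
    (hX : ∀ i, X i ∈ sisoGrading K (q i)) :
    coboundary (fun x y => sisoBracket K x y) (fun _ _ => 0) 0 (betaSiso K) q X = 0 := by
  rw [coboundary_four]
  rcases even_or_odd_of_mem_sisoGrading (hX 0) with ⟨q₀, Y₀, A₀, e₀⟩ | ⟨q₀, Ψ₀, e₀⟩ <;>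
    rcases even_or_odd_of_mem_sisoGrading (hX 1) with ⟨q₁, Y₁, A₁, e₁⟩ | ⟨q₁, Ψ₁, e₁⟩ <;>
    rcases even_or_odd_of_mem_sisoGrading (hX 2) with ⟨q₂, Y₂, A₂, e₂⟩ | ⟨q₂, Ψ₂, e₂⟩ <;>
    rcases even_or_odd_of_mem_sisoGrading (hX 3) with ⟨q₃, Y₃, A₃, e₃⟩ | ⟨q₃, Ψ₃, e₃⟩ <;>
    rcases even_or_odd_of_mem_sisoGrading (hX 4) with ⟨q₄, Y₄, A₄, e₄⟩ | ⟨q₄, Ψ₄, e₄⟩ <;>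
    simp only [q₀, q₁, q₂, q₃, q₄, e₀, e₁, e₂, e₃, e₄, mul_zero, mul_one, sgn_zero,
      sgn_one, sisoBracket_even_even, sisoBracket_even_odd, sisoBracket_odd_even,
      sisoBracket_odd_odd, betaSiso_vecCons, cliffordForm_zero_left, cliffordForm_zero_right,
      cliffordForm_apply_zero_left, cliffordForm_apply_zero_right, cliffordForm_apply_neg_left,
      smul_eq_mul, sub_zero, add_zero, zero_add, zero_sub, sub_self, neg_zero]
  · linarith [cliffordForm_poincare_invariant Y₀ Y₁ Y₂ A₀ A₁ A₂ Ψ₃ Ψ₄]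
  · linarith [cliffordForm_poincare_invariant Y₀ Y₁ Y₃ A₀ A₁ A₃ Ψ₂ Ψ₄]
  · linarith [cliffordForm_poincare_invariant Y₀ Y₁ Y₄ A₀ A₁ A₄ Ψ₂ Ψ₃]
  · linarith [cliffordForm_poincare_invariant Y₀ Y₂ Y₃ A₀ A₂ A₃ Ψ₁ Ψ₄]
  · linarith [cliffordForm_poincare_invariant Y₀ Y₂ Y₄ A₀ A₂ A₄ Ψ₁ Ψ₃]
  · linarith [cliffordForm_poincare_invariant Y₀ Y₃ Y₄ A₀ A₃ A₄ Ψ₁ Ψ₂]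
  · linarith [sum_cliffordForm_dot A₀ Ψ₁ Ψ₂ Ψ₃ Ψ₄]
  · linarith [cliffordForm_poincare_invariant Y₁ Y₂ Y₃ A₁ A₂ A₃ Ψ₀ Ψ₄]
  · linarith [cliffordForm_poincare_invariant Y₁ Y₂ Y₄ A₁ A₂ A₄ Ψ₀ Ψ₃]
  · linarith [cliffordForm_poincare_invariant Y₁ Y₃ Y₄ A₁ A₃ A₄ Ψ₀ Ψ₂]
  · linarith [sum_cliffordForm_dot A₁ Ψ₀ Ψ₂ Ψ₃ Ψ₄]
  · linarith [cliffordForm_poincare_invariant Y₂ Y₃ Y₄ A₂ A₃ A₄ Ψ₀ Ψ₁]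
  · linarith [sum_cliffordForm_dot A₂ Ψ₀ Ψ₁ Ψ₃ Ψ₄]
  · linarith [sum_cliffordForm_dot A₃ Ψ₀ Ψ₁ Ψ₂ Ψ₄]
  · linarith [sum_cliffordForm_dot A₄ Ψ₀ Ψ₁ Ψ₂ Ψ₃]

theorem betaSiso_isEvenCocycle : IsEvenCocycle (sisoGrading K) (evenGrading ℝ)
    (fun x y => sisoBracket K x y) (fun _ _ => 0) (betaSiso K) :=
  ⟨betaSiso_isCochain, betaSiso_cocycle⟩

theorem betaSiso_not_isCoboundary : ¬ IsCoboundary (sisoGrading K) (evenGrading ℝ)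
    (fun x y => sisoBracket K x y) (fun _ _ => 0) (betaSiso K) := by
  set Ψ : Spinor K := Sum.elim ![1, 0] ![0, 0] with hΨ
  set Φ : Spinor K := Sum.elim ![0, 0] ![0, 1] with hΦ
  have hdot : dot K Ψ Φ = 0 := ext_minkowski fun A => by
    obtain ⟨a, p, s, y, rfl⟩ := exists_eq_vec A
    rw [minkowski_dot, pairing_eq, gamma_vec, hΨ, hΦ]
    simp
  have hform : cliffordForm (vec 0 1 (-1) 0) (vec 0 0 0 1) Ψ Φ = -2 := by
    rw [cliffordForm_apply, pairing_eq, pairing_eq]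
    simp [gamma_vec, hΨ, hΦ, innerForm_apply, NormedDivisionAlgebra.re_one]
    norm_num
  refine not_isCoboundary_of_commuting ![1, 1, 0, 0]
    ![(0, 0, Ψ), (0, 0, Φ), (0, vec 0 1 (-1) 0, 0), (0, vec 0 0 0 1, 0)] (fun i => ?_)
    (fun i j hij => ?_) ?_
  · fin_cases i
    · exact odd_mem_sisoGrading _
    · exact odd_mem_sisoGrading _
    · exact even_mem_sisoGrading _ _
    · exact even_mem_sisoGrading _ _
  · fin_cases i <;> fin_cases j <;> first
      | exact absurd hij (by decide)
      | simp [sisoBracket_apply, hdot]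
  · rw [betaSiso_eq]
    simp [hform]

end BetaSiso

/-! ## The signature of spacetime -/

theorem exists_orthonormal_basis {V : Type*} [AddCommGroup V] [Module ℝ V] [Module.Finite ℝ V]
    {B : LinearMap.BilinForm ℝ V} (hB : B.IsSymm) (hpos : ∀ x ≠ 0, 0 < B x x) :
    ∃ f : Module.Basis (Fin (Module.finrank ℝ V)) ℝ V, ∀ i j,
      B (f i) (f j) = if i = j then 1 else 0 := by
  obtain ⟨v, hv⟩ := LinearMap.BilinForm.exists_orthogonal_basis (B := B) ⟨hB.eq⟩
  have hsqrt : ∀ i, √(B (v i) (v i)) ≠ 0 := fun i =>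
    (Real.sqrt_pos.mpr (hpos _ (v.ne_zero i))).ne'
  refine ⟨v.isUnitSMul fun i => (inv_ne_zero (hsqrt i)).isUnit, fun i j => ?_⟩
  rw [Module.Basis.isUnitSMul_apply, Module.Basis.isUnitSMul_apply, map_smul, LinearMap.map_smul₂,
    smul_eq_mul, smul_eq_mul]
  split_ifs with hij
  · subst hij
    have hsq := Real.mul_self_sqrt (hpos _ (v.ne_zero i)).le
    field_simp [hsqrt i]
    linarith
  · rw [show B (v i) (v j) = 0 from hv hij, mul_zero, mul_zero]

section Minkowski

variable {K : Type} [NormedDivisionAlgebra K] {n : ℕ}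

/-- The off-diagonal vectors, as a linear map; they form the Euclidean subspace of `Vec K`
isometric to `K`. -/
noncomputable def offDiagonal : K →ₗ[ℝ] Vec K where
  toFun y := vec 0 0 0 y
  map_add' y y' := by rw [vec_add, add_zero]
  map_smul' r y := by rw [RingHom.id_apply, vec_smul, mul_zero]

theorem offDiagonal_apply (y : K) : offDiagonal y = vec 0 0 0 y :=
  rfl

/-- The Lorentz frame of `Vec K` completing a family `f` in `K`: the timelike vector, which is the
identity matrix in `h₂(K)`, comes first. -/
noncomputable def lorentzFrame (f : Fin n → K) : Fin (n + 3) → Vec K :=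
  Fin.cons (vec 0 1 1 0) (Fin.cons (vec 0 1 (-1) 0)
    (Fin.cons (vec 1 0 0 0) fun i => offDiagonal (f i)))

theorem minkowski_lorentzFrame {f : Fin n → K}
    (hf : ∀ i j, innerForm (f i) (f j) = if i = j then 1 else 0) (i j : Fin (n + 3)) :
    minkowski K (lorentzFrame f i) (lorentzFrame f j) =
      if i = j then (if i = 0 then -1 else 1) else 0 := by
  have hzero_eq_succ : ∀ (m : ℕ) (j : Fin m), (0 = j.succ) = False := fun m j =>
    eq_false (Fin.succ_ne_zero j).symm
  refine Fin.cases ?_ (Fin.cases ?_ (Fin.cases ?_ fun i => ?_)) i <;>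
    refine Fin.cases ?_ (Fin.cases ?_ (Fin.cases ?_ fun j => ?_)) j <;>
    simp only [lorentzFrame, Fin.cons_zero, Fin.cons_succ, offDiagonal_apply, minkowski_vec, hf,
      Fin.succ_inj, Fin.succ_ne_zero, hzero_eq_succ, if_true, if_false, map_zero,
      LinearMap.zero_apply] <;>
    norm_num

theorem linearIndependent_lorentzFrame {f : Fin n → K}
    (hf : ∀ i j, innerForm (f i) (f j) = if i = j then 1 else 0) :
    LinearIndependent ℝ (lorentzFrame f) := by
  refine LinearMap.BilinForm.linearIndependent_of_iIsOrtho (B := minkowski K)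
    (fun i j hij => (minkowski_lorentzFrame hf i j).trans (if_neg hij)) fun i hi => ?_
  have hself : minkowski K (lorentzFrame f i) (lorentzFrame f i) = 0 := hi
  rw [minkowski_lorentzFrame hf, if_pos rfl] at hself
  split_ifs at hself <;> norm_num at hself

theorem span_lorentzFrame {f : Fin n → K} (hf : Submodule.span ℝ (Set.range f) = ⊤) :
    Submodule.span ℝ (Set.range (lorentzFrame f)) = ⊤ := by
  refine eq_top_iff.mpr fun M _ => ?_
  obtain ⟨a, p, s, y, rfl⟩ := exists_eq_vec M
  have hmem : ∀ i, lorentzFrame f i ∈ Submodule.span ℝ (Set.range (lorentzFrame f)) := fun i =>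
    Submodule.subset_span ⟨i, rfl⟩
  have hle : Submodule.span ℝ (Set.range f) ≤
      (Submodule.span ℝ (Set.range (lorentzFrame f))).comap offDiagonal :=
    Submodule.span_le.mpr (Set.range_subset_iff.mpr fun i => hmem i.succ.succ.succ)
  have hy : offDiagonal y ∈ Submodule.span ℝ (Set.range (lorentzFrame f)) :=
    hle (hf ▸ Submodule.mem_top)
  have hM : vec a p s y = ((p + s) / 2) • lorentzFrame f 0 +
      ((p - s) / 2) • lorentzFrame f (Fin.succ 0) +
      a • lorentzFrame f (Fin.succ (Fin.succ 0)) + offDiagonal y := by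
    simp only [lorentzFrame, Fin.cons_zero, Fin.cons_succ, offDiagonal_apply, vec_smul, vec_add]
    congr 1
    · ring
    · ring
    · ring
    · simp only [smul_zero, zero_add]
  rw [hM]
  exact add_mem (add_mem (add_mem (Submodule.smul_mem _ _ (hmem _))
    (Submodule.smul_mem _ _ (hmem _))) (Submodule.smul_mem _ _ (hmem _))) hy

theorem exists_minkowski_basis (K : Type) [NormedDivisionAlgebra K] :
    ∃ e : Module.Basis (Fin (Module.finrank ℝ K + 3)) ℝ (Vec K), ∀ i j,
      minkowski K (e i) (e j) = if i = j then (if i = 0 then -1 else 1) else 0 := by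
  obtain ⟨f, hf⟩ := exists_orthonormal_basis (B := innerForm) ⟨innerForm_comm⟩
    fun _ (hx : (_ : K) ≠ 0) => innerForm_self_pos hx
  refine ⟨Module.Basis.mk (linearIndependent_lorentzFrame hf) (span_lorentzFrame f.span_eq).ge,
    fun i j => ?_⟩
  rw [Module.Basis.mk_apply, Module.Basis.mk_apply, minkowski_lorentzFrame hf]

end Minkowski

theorem finrank_carrier (k : DivAlg) : Module.finrank ℝ k.carrier = k.dim := by
  cases k
  · exact Module.finrank_self ℝ
  · exact Complex.finrank_real_complex
  · exact Quaternion.finrank_eq_four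
  · refine (Module.finrank_prod (R := ℝ) (M := ℍ[ℝ]) (M' := ℍ[ℝ])).trans ?_
    rw [Quaternion.finrank_eq_four]
    rfl

theorem mainTheorem1_general (K : Type) [NormedDivisionAlgebra K] :
    (∃ e : Module.Basis (Fin (Module.finrank ℝ K + 3)) ℝ (Vec K), ∀ i j,
      minkowski K (e i) (e j) = if i = j then (if i = 0 then -1 else 1) else 0) ∧
    IsLieSuperalgebra (sisoGrading K) (sisoBracket K) ∧
    IsEvenCocycle (sisoGrading K) (evenGrading ℝ) (fun x y => sisoBracket K x y) (fun _ _ => 0)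
      (betaSiso K) ∧
    ¬ IsCoboundary (sisoGrading K) (evenGrading ℝ) (fun x y => sisoBracket K x y) (fun _ _ => 0)
      (betaSiso K) ∧
    LInftyData.IsLieNSuperalgebra 3 (twoBrane K) ∧
    ¬ LInftyData.IsExact 2 (twoBrane K) ∧
    LInftyData.IsShortExact LInftyData.bTwoR (twoBrane K)
      (LInftyData.ofLie (sisoGrading K) (sisoBracket K)) (LinearMap.inr ℝ (Siso K) ℝ)
      (LinearMap.fst ℝ (Siso K) ℝ) :=
  ⟨exists_minkowski_basis K, siso_isLieSuperalgebra, betaSiso_isEvenCocycle,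
    betaSiso_not_isCoboundary,
    LInftyData.extension_isLieNSuperalgebra siso_isLieSuperalgebra betaSiso_isEvenCocycle,
    fun h => betaSiso_not_isCoboundary (LInftyData.isCoboundary_of_isExact_extension h),
    LInftyData.extension_isShortExact siso_isLieSuperalgebra betaSiso_isEvenCocycle⟩

end Brane

/-- Let `K` be `ℝ`, `ℂ`, `ℍ` or `𝕆`, of dimension `n`. -/
theorem mainTheorem1 (k : DivAlg) :
    -- the vectors form a Minkowski spacetime of dimension `n + 3 = 4, 5, 7, 11`
    (∃ e : Module.Basis (Fin (k.dim + 3)) ℝ (Vec k.carrier), ∀ i j,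
      minkowski k.carrier (e i) (e j) = if i = j then (if i = 0 then -1 else 1) else 0) ∧
    -- the Poincaré superalgebra is a Lie superalgebra
    IsLieSuperalgebra (sisoGrading k.carrier) (sisoBracket k.carrier) ∧
    -- `β` is an even 4-cocycle on it with values in the trivial representation, and nontrivial
    IsEvenCocycle (sisoGrading k.carrier) (evenGrading ℝ) (fun x y => sisoBracket k.carrier x y)
      (fun _ _ => 0) (betaSiso k.carrier) ∧
    ¬ IsCoboundary (sisoGrading k.carrier) (evenGrading ℝ) (fun x y => sisoBracket k.carrier x y)
      (fun _ _ => 0) (betaSiso k.carrier) ∧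
    -- the extension by `β` is a nonexact Lie 3-superalgebra
    LInftyData.IsLieNSuperalgebra 3 (twoBrane k.carrier) ∧
    ¬ LInftyData.IsExact 2 (twoBrane k.carrier) ∧
    -- it is an extension of the Poincaré superalgebra by `b²ℝ`
    LInftyData.IsShortExact LInftyData.bTwoR (twoBrane k.carrier)
      (LInftyData.ofLie (sisoGrading k.carrier) (sisoBracket k.carrier))
      (LinearMap.inr ℝ (Siso k.carrier) ℝ) (LinearMap.fst ℝ (Siso k.carrier) ℝ) := by
  rw [← finrank_carrier]
  exact mainTheorem1_general k.carrier
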